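/- Let \(S\subset\mathbb{R}^3\) be the unit sphere with surface measure, let \(R\subset\mathbb{R}^d\) be a non-empty bounded convex open set with Lebesgue measure, and let \(\mathbb{V}=L^2(S\times R)\) be the real Hilbert space with inner product \((u,w)=\int_{S\times R}uw\). Let \(\sigma_a,\sigma_s\in L^\infty(R)\) with \(\sigma_s\ge 0\) a.e. and \(\sigma_a\ge\gamma\) a.e. for some constant \(\gamma>0\). Put \(\sigma_t=\sigma_a+\sigma_s\) and \(c=\|\sigma_s/\sigma_t\|_{L^\infty(R)}\). Let \(0\le g<1\) and let \[ k(t)=\frac{1}{4\pi}\,\frac{1-g^2}{(1-2gt+g^2)^{3/2}} \] be the Henyey–Greenstein phase function. Define bounded operators on \(\mathbb{V}\) by \[ (\mathcal{M}v)(s,r)=\sigma_t(r)v(s,r),\qquad (\mathcal{S}v)(s,r)=\int_S k(s\cdot s')\,v(s',r)\,ds',\qquad \mathcal{K}v=\sigma_s\,\mathcal{S}v . \] For each \(l\in\mathbb{N}_0\) let \(H^l_m\), \(-l\le m\le l\), be real spherical harmonics of degree \(l\) (restrictions to \(S\) of harmonic homogeneous polynomials of degree \(l\)) that are orthonormal in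 \(L^2(S)\). For \(N\in\mathbb{N}_0\) set \[ \mathcal{S}_Nv=\sum_{l=0}^{N}g^l\sum_{m=-l}^{l}(v,H^l_m)_S\,H^l_m,\qquad \mathcal{K}_Nv=\sigma_s\,\mathcal{S}_Nv , \] where \((v,H^l_m)_S(r)=\int_S v(s',r)H^l_m(s')\,ds'\) and \(g^0=1\). Then for all \(v\in\mathbb{V}\) \[ \big(1-c\,g^{N+1}\big)\,((\mathcal{M}-\mathcal{K}_N)v,v)\;\le\;((\mathcal{M}-\mathcal{K})v,v)\;\le\;((\mathcal{M}-\mathcal{K}_N)v,v). \] Moreover \(\mathcal{M}-\mathcal{K}_N\) is invertible on \(\mathbb{V}\) with bounded inverse. -/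

import Mathlib

open MeasureTheory

noncomputable section

namespace RadiativeTransfer

/-! ### The phase space and its Hilbert space -/

/-- The unit sphere in three-dimensional Euclidean space, the set of directions. -/
abbrev S2 : Type := Metric.sphere (0 : EuclideanSpace ℝ (Fin 3)) 1

/-- The surface measure on the unit sphere, of total mass `4 * π`. -/
abbrev surf : Measure S2 := (volume : Measure (EuclideanSpace ℝ (Fin 3))).toSphere

/-- Lebesgue measure on the spatial domain `R`. -/
abbrev spaceMeas {d : ℕ} (R : Set (EuclideanSpace ℝ (Fin d))) :
    Measure (EuclideanSpace ℝ (Fin d)) :=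
  volume.restrict R

/-- The product of surface and Lebesgue measure on the phase space `D = S × R`. -/
abbrev phaseMeas {d : ℕ} (R : Set (EuclideanSpace ℝ (Fin d))) :
    Measure (S2 × EuclideanSpace ℝ (Fin d)) :=
  surf.prod (spaceMeas R)

/-- The real Hilbert space `V = L²(S × R)`. -/
abbrev V {d : ℕ} (R : Set (EuclideanSpace ℝ (Fin d))) : Type :=
  Lp ℝ 2 (phaseMeas R)

/-- The space `L^∞(R)` of optical parameters. -/
abbrev Linf {d : ℕ} (R : Set (EuclideanSpace ℝ (Fin d))) : Type :=
  Lp ℝ ⊤ (spaceMeas R)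

/-! ### Multiplication by a bounded function of position -/

section Mul

variable {d : ℕ} {R : Set (EuclideanSpace ℝ (Fin d))}

lemma memLp_snd (σ : Linf R) :
    MemLp (fun p : S2 × EuclideanSpace ℝ (Fin d) => σ p.2) ⊤ (phaseMeas R) := by
  have hσ : AEStronglyMeasurable (fun p : S2 × EuclideanSpace ℝ (Fin d) => σ p.2)
      (phaseMeas R) :=
    ((Lp.stronglyMeasurable σ).comp_measurable measurable_snd).aestronglyMeasurable
  refine memLp_top_of_bound hσ ‖σ‖ ?_
  have h : ∀ᵐ r ∂(spaceMeas R), ‖σ r‖ ≤ ‖σ‖ := by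
    have h1 := ae_le_eLpNormEssSup (f := (σ : EuclideanSpace ℝ (Fin d) → ℝ)) (μ := spaceMeas R)
    filter_upwards [h1] with r hr
    rw [Lp.norm_def, eLpNorm_exponent_top]
    have hfin : eLpNormEssSup (σ : EuclideanSpace ℝ (Fin d) → ℝ) (spaceMeas R) ≠ ⊤ := by
      rw [← eLpNorm_exponent_top]; exact Lp.eLpNorm_ne_top σ
    simpa using ENNReal.toReal_mono hfin hr
  exact Measure.quasiMeasurePreserving_snd.ae h

lemma memLp_mul (σ : Linf R) (v : V R) :
    MemLp (fun p : S2 × EuclideanSpace ℝ (Fin d) => σ p.2 * v p) 2 (phaseMeas R) :=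
  (Lp.memLp v).mul (memLp_snd σ)

lemma mulOp_bound (σ : Linf R) (v : V R) :
    ‖(memLp_mul σ v).toLp _‖ ≤
      (eLpNorm (fun p : S2 × EuclideanSpace ℝ (Fin d) => σ p.2) ⊤ (phaseMeas R)).toReal * ‖v‖ := by
  rw [Lp.norm_toLp, Lp.norm_def, ← ENNReal.toReal_mul]
  refine ENNReal.toReal_mono
    (ENNReal.mul_ne_top (memLp_snd σ).eLpNorm_ne_top (Lp.eLpNorm_ne_top v)) ?_
  have h := eLpNorm_smul_le_mul_eLpNorm (p := ⊤) (q := 2) (r := 2)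
    (Lp.aestronglyMeasurable v) (memLp_snd σ).aestronglyMeasurable
  exact h

/-- The multiplication operator `(σ v)(s, r) = σ(r) v(s, r)` on `V`. -/
def mulOp (σ : Linf R) : V R →L[ℝ] V R :=
  LinearMap.mkContinuous
    { toFun := fun v => (memLp_mul σ v).toLp _
      map_add' := fun v w => by
        rw [← MemLp.toLp_add]
        refine MemLp.toLp_congr _ _ ?_
        filter_upwards [Lp.coeFn_add v w] with p hp
        simp only [hp, Pi.add_apply, mul_add]
      map_smul' := fun a v => by
        rw [RingHom.id_apply, ← MemLp.toLp_const_smul]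
        refine MemLp.toLp_congr _ _ ?_
        filter_upwards [Lp.coeFn_smul a v] with p hp
        simp only [hp, Pi.smul_apply, smul_eq_mul]; ring }
    (eLpNorm (fun p : S2 × EuclideanSpace ℝ (Fin d) => σ p.2) ⊤ (phaseMeas R)).toReal
    (fun v => mulOp_bound σ v)

theorem mulOp_ae (σ : Linf R) (v : V R) :
    mulOp σ v =ᵐ[phaseMeas R] fun p => σ p.2 * v p :=
  MemLp.coeFn_toLp (memLp_mul σ v)

end Mul

/-! ### Integral operators in the angular variable -/

section Angular

variable {d : ℕ} {R : Set (EuclideanSpace ℝ (Fin d))}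

/-- The function `(s, r) ↦ ∫_S κ(s, s') v(s', r) ds'`. -/
def angularFun (κ : C(S2 × S2, ℝ)) (v : V R) (p : S2 × EuclideanSpace ℝ (Fin d)) : ℝ :=
  ∫ s', κ (p.1, s') * v (s', p.2) ∂surf

lemma angularFun_stronglyMeasurable (κ : C(S2 × S2, ℝ)) (v : V R) :
    StronglyMeasurable (angularFun κ v) := by
  have h : StronglyMeasurable (fun q : (S2 × EuclideanSpace ℝ (Fin d)) × S2 =>
      κ (q.1.1, q.2) * v (q.2, q.1.2)) := by
    refine StronglyMeasurable.mul ?_ ?_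
    · exact κ.continuous.stronglyMeasurable.comp_measurable (by fun_prop)
    · exact (Lp.stronglyMeasurable v).comp_measurable (by fun_prop)
  exact h.integral_prod_right

lemma slice_memLp (v : V R) :
    ∀ᵐ r ∂(spaceMeas R), MemLp (fun s => v (s, r)) 2 surf := by
  have h := (Lp.memLp v).integrable_sq
  filter_upwards [h.prod_left_ae] with r hr
  exact (memLp_two_iff_integrable_sq
    ((Lp.stronglyMeasurable v).comp_measurable (by fun_prop)).aestronglyMeasurable).2 hr

lemma slice_integrable (κ : C(S2 × S2, ℝ)) (v : V R) :
    ∀ᵐ p ∂(phaseMeas R), Integrable (fun s' => κ (p.1, s') * v (s', p.2)) surf := by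
  refine Measure.quasiMeasurePreserving_snd.ae (μb := spaceMeas R)
    (p := fun r => MemLp (fun s => v (s, r)) 2 surf) (slice_memLp v) |>.mono ?_
  intro p hp
  refine (hp.integrable one_le_two).bdd_mul (c := ‖κ‖) ?_ ?_
  · exact (κ.continuous.comp (by fun_prop)).aestronglyMeasurable
  · exact Filter.Eventually.of_forall fun s' => κ.norm_coe_le_norm _

lemma angularFun_enorm_sq_le (κ : C(S2 × S2, ℝ)) (v : V R)
    (p : S2 × EuclideanSpace ℝ (Fin d)) :
    ‖angularFun κ v p‖ₑ ^ (2 : ℝ) ≤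
      (‖κ‖ₑ ^ (2 : ℝ) * surf Set.univ) * ∫⁻ s', ‖v (s', p.2)‖ₑ ^ (2 : ℝ) ∂surf := by
  have hm : AEMeasurable (fun s' => ‖v (s', p.2)‖ₑ) surf :=
    ((Lp.stronglyMeasurable v).comp_measurable (by fun_prop)).measurable.enorm.aemeasurable
  have h1 : ‖angularFun κ v p‖ₑ ≤ ‖κ‖ₑ * ∫⁻ s', ‖v (s', p.2)‖ₑ ∂surf := by
    refine (enorm_integral_le_lintegral_enorm _).trans ?_
    rw [← lintegral_const_mul'' _ hm]
    refine lintegral_mono fun s' => ?_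
    rw [enorm_mul]
    gcongr
    exact enorm_le_iff_norm_le.2 (κ.norm_coe_le_norm _)
  have h2 : ∫⁻ s', ‖v (s', p.2)‖ₑ ∂surf ≤
      (∫⁻ s', ‖v (s', p.2)‖ₑ ^ (2 : ℝ) ∂surf) ^ (1 / 2 : ℝ) * surf Set.univ ^ (1 / 2 : ℝ) := by
    have := ENNReal.lintegral_mul_le_Lp_mul_Lq surf Real.HolderConjugate.two_two hm
      (aemeasurable_const (b := (1 : ENNReal)))
    simpa using this
  calc ‖angularFun κ v p‖ₑ ^ (2 : ℝ)
      ≤ (‖κ‖ₑ * ((∫⁻ s', ‖v (s', p.2)‖ₑ ^ (2 : ℝ) ∂surf) ^ (1 / 2 : ℝ) *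
          surf Set.univ ^ (1 / 2 : ℝ))) ^ (2 : ℝ) := by
        gcongr
        exact h1.trans (by gcongr)
    _ = _ := by
        rw [ENNReal.mul_rpow_of_nonneg _ _ (by norm_num),
          ENNReal.mul_rpow_of_nonneg _ _ (by norm_num), ← ENNReal.rpow_mul, ← ENNReal.rpow_mul]
        norm_num
        ring

lemma angularFun_eLpNorm_le (κ : C(S2 × S2, ℝ)) (v : V R) :
    eLpNorm (angularFun κ v) 2 (phaseMeas R) ≤
      (‖κ‖ₑ * surf Set.univ) * eLpNorm v 2 (phaseMeas R) := by
  have hvm : Measurable (fun q : S2 × EuclideanSpace ℝ (Fin d) => ‖v q‖ₑ ^ (2 : ℝ)) :=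
    ((Lp.stronglyMeasurable v).measurable.enorm).pow_const _
  have key : ∫⁻ p, ‖angularFun κ v p‖ₑ ^ (2 : ℝ) ∂(phaseMeas R) ≤
      ((‖κ‖ₑ * surf Set.univ) ^ (2 : ℝ)) * ∫⁻ p, ‖v p‖ₑ ^ (2 : ℝ) ∂(phaseMeas R) := by
    refine (lintegral_mono (angularFun_enorm_sq_le κ v)).trans (le_of_eq ?_)
    have hin : Measurable (fun r : EuclideanSpace ℝ (Fin d) =>
        ∫⁻ s', ‖v (s', r)‖ₑ ^ (2 : ℝ) ∂surf) := hvm.lintegral_prod_left'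
    have e1 : ∫⁻ p, ((‖κ‖ₑ ^ (2 : ℝ) * surf Set.univ) *
          ∫⁻ s', ‖v (s', p.2)‖ₑ ^ (2 : ℝ) ∂surf) ∂(phaseMeas R) =
        (‖κ‖ₑ ^ (2 : ℝ) * surf Set.univ) *
          ∫⁻ p, ∫⁻ s', ‖v (s', p.2)‖ₑ ^ (2 : ℝ) ∂surf ∂(phaseMeas R) :=
      lintegral_const_mul _ (hin.comp measurable_snd)
    have e2 : ∫⁻ p, ∫⁻ s', ‖v (s', p.2)‖ₑ ^ (2 : ℝ) ∂surf ∂(phaseMeas R) =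
        (∫⁻ p, ‖v p‖ₑ ^ (2 : ℝ) ∂(phaseMeas R)) * surf Set.univ := by
      have e3 := lintegral_prod (μ := surf) (ν := spaceMeas R)
        (fun p => ∫⁻ s', ‖v (s', p.2)‖ₑ ^ (2 : ℝ) ∂surf) (hin.comp measurable_snd).aemeasurable
      rw [e3, lintegral_prod_symm' _ hvm]
      change ∫⁻ _, (∫⁻ y, ∫⁻ s', ‖v (s', y)‖ₑ ^ (2 : ℝ) ∂surf ∂(spaceMeas R)) ∂surf = _
      rw [lintegral_const]
    rw [e1, e2, ENNReal.mul_rpow_of_nonneg _ _ (by norm_num : (0 : ℝ) ≤ 2)]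
    simp only [ENNReal.rpow_two]
    ring
  rw [eLpNorm_eq_lintegral_rpow_enorm_toReal (by norm_num) (by norm_num),
    eLpNorm_eq_lintegral_rpow_enorm_toReal (by norm_num) (by norm_num)]
  simp only [ENNReal.toReal_ofNat]
  calc _ ≤ (((‖κ‖ₑ * surf Set.univ) ^ (2 : ℝ)) *
        ∫⁻ p, ‖v p‖ₑ ^ (2 : ℝ) ∂(phaseMeas R)) ^ (1 / 2 : ℝ) := by gcongr
    _ = _ := by
      rw [ENNReal.mul_rpow_of_nonneg _ _ (by norm_num), ← ENNReal.rpow_mul]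
      norm_num

lemma angular_const_ne_top (κ : C(S2 × S2, ℝ)) : ‖κ‖ₑ * surf Set.univ ≠ ⊤ :=
  ENNReal.mul_ne_top (by simp) (measure_ne_top _ _)

lemma angularFun_memLp (κ : C(S2 × S2, ℝ)) (v : V R) :
    MemLp (angularFun κ v) 2 (phaseMeas R) :=
  ⟨(angularFun_stronglyMeasurable κ v).aestronglyMeasurable,
    (angularFun_eLpNorm_le κ v).trans_lt
      (ENNReal.mul_ne_top (angular_const_ne_top κ) (Lp.eLpNorm_ne_top v)).lt_top⟩

lemma ae_slice {P : S2 × EuclideanSpace ℝ (Fin d) → Prop} (hP : ∀ᵐ q ∂(phaseMeas R), P q) :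
    ∀ᵐ p ∂(phaseMeas R), ∀ᵐ s' ∂surf, P (s', p.2) := by
  refine Measure.quasiMeasurePreserving_snd.ae (μb := spaceMeas R)
    (p := fun r => ∀ᵐ s' ∂surf, P (s', r)) ?_
  have h := Measure.ae_ae_of_ae_prod
    ((Measure.measurePreserving_swap (μ := spaceMeas R) (ν := surf)).quasiMeasurePreserving.ae hP)
  exact h

lemma angularOp_bound (κ : C(S2 × S2, ℝ)) (v : V R) :
    ‖(angularFun_memLp κ v).toLp _‖ ≤ (‖κ‖ₑ * surf Set.univ).toReal * ‖v‖ := by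
  rw [Lp.norm_toLp, Lp.norm_def, ← ENNReal.toReal_mul]
  exact ENNReal.toReal_mono
    (ENNReal.mul_ne_top (angular_const_ne_top κ) (Lp.eLpNorm_ne_top v))
    (angularFun_eLpNorm_le κ v)

/-- The integral operator `v ↦ ((s, r) ↦ ∫_S κ(s, s') v(s', r) ds')` on `V`, for a continuous
kernel `κ` on `S × S`. -/
def angularOp (κ : C(S2 × S2, ℝ)) : V R →L[ℝ] V R :=
  LinearMap.mkContinuous
    { toFun := fun v => (angularFun_memLp κ v).toLp _
      map_add' := fun v w => by
        rw [← MemLp.toLp_add]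
        refine MemLp.toLp_congr _ _ ?_
        filter_upwards [ae_slice (Lp.coeFn_add v w), slice_integrable κ v,
          slice_integrable κ w] with p hp hv hw
        simp only [Pi.add_apply, angularFun]
        rw [← integral_add hv hw]
        refine integral_congr_ae ?_
        filter_upwards [hp] with s' hs'
        rw [hs', Pi.add_apply, mul_add]
      map_smul' := fun a v => by
        rw [RingHom.id_apply, ← MemLp.toLp_const_smul]
        refine MemLp.toLp_congr _ _ ?_
        filter_upwards [ae_slice (Lp.coeFn_smul a v)] with p hp
        simp only [Pi.smul_apply, angularFun, smul_eq_mul]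
        rw [← integral_const_mul]
        refine integral_congr_ae ?_
        filter_upwards [hp] with s' hs'
        rw [hs', Pi.smul_apply, smul_eq_mul]; ring }
    (‖κ‖ₑ * surf Set.univ).toReal
    (fun v => angularOp_bound κ v)

theorem angularOp_ae (κ : C(S2 × S2, ℝ)) (v : V R) :
    angularOp κ v =ᵐ[phaseMeas R] fun p => ∫ s', κ (p.1, s') * v (s', p.2) ∂surf :=
  MemLp.coeFn_toLp (angularFun_memLp κ v)

end Angular

/-! ### The Henyey–Greenstein scattering operator -/

/-- The Henyey–Greenstein phase function with anisotropy factor `g`, as a function of the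
cosine `t` of the scattering angle. -/
def hgPhase (g t : ℝ) : ℝ :=
  1 / (4 * Real.pi) * ((1 - g ^ 2) / (1 - 2 * g * t + g ^ 2) ^ (3 / 2 : ℝ))

lemma hg_denom_pos {g : ℝ} (hg0 : 0 ≤ g) (hg1 : g < 1) {t : ℝ} (ht : t ≤ 1) :
    0 < 1 - 2 * g * t + g ^ 2 := by
  nlinarith [mul_le_mul_of_nonneg_left ht hg0, mul_pos (sub_pos.2 hg1) (sub_pos.2 hg1)]

lemma inner_le_one (s s' : S2) :
    inner ℝ (s : EuclideanSpace ℝ (Fin 3)) (s' : EuclideanSpace ℝ (Fin 3)) ≤ 1 := by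
  have h := real_inner_le_norm (s : EuclideanSpace ℝ (Fin 3)) (s' : EuclideanSpace ℝ (Fin 3))
  simpa [norm_eq_of_mem_sphere] using h

/-- The scattering kernel `(s, s') ↦ k(s · s')` on `S × S`. -/
def hgKernel (g : ℝ) (hg0 : 0 ≤ g) (hg1 : g < 1) : C(S2 × S2, ℝ) where
  toFun p := hgPhase g
    (inner ℝ (p.1 : EuclideanSpace ℝ (Fin 3)) (p.2 : EuclideanSpace ℝ (Fin 3)))
  continuous_toFun := by
    unfold hgPhase
    refine continuous_const.mul (continuous_const.div ?_ ?_)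
    · refine Continuous.rpow_const (by fun_prop) fun p => Or.inr (by norm_num)
    · intro p
      exact (Real.rpow_pos_of_pos (hg_denom_pos hg0 hg1 (inner_le_one _ _)) _).ne'

/-- The scattering operator `(S u)(s, r) = ∫_S k(s · s') u(s', r) ds'` on `V`. -/
def scatOp {d : ℕ} (R : Set (EuclideanSpace ℝ (Fin d))) (g : ℝ) (hg0 : 0 ≤ g) (hg1 : g < 1) :
    V R →L[ℝ] V R :=
  angularOp (hgKernel g hg0 hg1)

/-! ### Spherical harmonics -/

/-- The Laplacian on real polynomials in three variables. -/
def polyLaplacian : MvPolynomial (Fin 3) ℝ →ₗ[ℝ] MvPolynomial (Fin 3) ℝ :=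
  ∑ i : Fin 3, (MvPolynomial.pderiv i).toLinearMap ∘ₗ (MvPolynomial.pderiv i).toLinearMap

/-- A real spherical harmonic of degree `l`: the restriction to the unit sphere of a harmonic
homogeneous polynomial of degree `l`. -/
def IsSphericalHarmonic (l : ℕ) (f : C(S2, ℝ)) : Prop :=
  ∃ p : MvPolynomial (Fin 3) ℝ, p.IsHomogeneous l ∧ polyLaplacian p = 0 ∧
    ∀ s : S2, f s = MvPolynomial.eval (fun i => (s : EuclideanSpace ℝ (Fin 3)) i) p

/-- `H l m`, for `-l ≤ m ≤ l`, are `2 * l + 1` spherical harmonics of degree `l` that are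
orthonormal in `L²(S)`; the values of `H l m` for other `m` are irrelevant. -/
structure IsSphericalHarmonics (H : ℕ → ℤ → C(S2, ℝ)) : Prop where
  harmonic : ∀ l : ℕ, ∀ m ∈ Finset.Icc (-l : ℤ) l, IsSphericalHarmonic l (H l m)
  orthonormal : ∀ l : ℕ, ∀ m ∈ Finset.Icc (-l : ℤ) l, ∀ m' ∈ Finset.Icc (-l : ℤ) l,
    ∫ s, H l m s * H l m' s ∂surf = if m = m' then 1 else 0

/-! ### Existence of orthonormal families of spherical harmonics of each degree -/

lemma polyLaplacian_isHomogeneous {l : ℕ} {p : MvPolynomial (Fin 3) ℝ}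
    (hp : p.IsHomogeneous l) : (polyLaplacian p).IsHomogeneous (l - 2) := by
  simp only [polyLaplacian, LinearMap.sum_apply]
  refine MvPolynomial.IsHomogeneous.sum _ _ _ fun i _ => ?_
  exact (hp.pderiv (i := i)).pderiv (i := i)

lemma finrank_homogeneous (l : ℕ) :
    2 * Module.finrank ℝ (MvPolynomial.homogeneousSubmodule (Fin 3) ℝ l) = (l + 2) * (l + 1) := by
  have hb : Module.finrank ℝ (MvPolynomial.homogeneousSubmodule (Fin 3) ℝ l) =
      Nat.card {d : Fin 3 →₀ ℕ | d.degree = l} := by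
    rw [MvPolynomial.homogeneousSubmodule_eq_finsupp_supported]
    exact Module.finrank_eq_nat_card_basis
      (MvPolynomial.basisRestrictSupport ℝ {d : Fin 3 →₀ ℕ | d.degree = l})
  have hs : {d : Fin 3 →₀ ℕ | d.degree = l} =
      (Finset.finsuppAntidiag Finset.univ l : Finset (Fin 3 →₀ ℕ)) := by
    ext d; simp [Finset.mem_finsuppAntidiag, Finsupp.degree_eq_sum]
  have h2 := Finset.card_finsuppAntidiag_nat_eq_choose (s := (Finset.univ : Finset (Fin 3))) l
  have h3 : (Finset.card (Finset.univ : Finset (Fin 3)) + l - 1).choose l =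
      (l + 2).choose 2 := by
    rw [Finset.card_univ, Fintype.card_fin, show 3 + l - 1 = l + 2 by omega]
    exact (Nat.choose_symm_add (a := l) (b := 2))
  have h4 : Nat.card ((Finset.finsuppAntidiag Finset.univ l : Finset (Fin 3 →₀ ℕ)) :
      Set (Fin 3 →₀ ℕ)) = (Finset.finsuppAntidiag (Finset.univ : Finset (Fin 3)) l).card := by
    rw [SetLike.coe_sort_coe, Nat.card_eq_fintype_card, Fintype.card_coe]
  rw [hb, hs, h4, h2, h3, Nat.choose_two_right,
    Nat.mul_div_cancel']
  · rfl
  · exact (Nat.even_mul_pred_self _).two_dvd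

/-- Harmonic homogeneous polynomials of degree `l`. -/
def harmonicPoly (l : ℕ) : Submodule ℝ (MvPolynomial.homogeneousSubmodule (Fin 3) ℝ l) :=
  LinearMap.ker (polyLaplacian ∘ₗ (MvPolynomial.homogeneousSubmodule (Fin 3) ℝ l).subtype)

lemma finrank_harmonicPoly (l : ℕ) : 2 * l + 1 ≤ Module.finrank ℝ (harmonicPoly l) := by
  have hfin : ∀ n, Module.Finite ℝ (MvPolynomial.homogeneousSubmodule (Fin 3) ℝ n) := fun n =>
    Module.Finite.iff_fg.2 (MvPolynomial.homogeneousSubmodule_fg _ _ n)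
  have := hfin l
  have h := LinearMap.finrank_range_add_finrank_ker
    (polyLaplacian ∘ₗ (MvPolynomial.homogeneousSubmodule (Fin 3) ℝ l).subtype)
  change _ + Module.finrank ℝ (harmonicPoly l) = _ at h
  have hl := finrank_homogeneous l
  have hr : LinearMap.range
      (polyLaplacian ∘ₗ (MvPolynomial.homogeneousSubmodule (Fin 3) ℝ l).subtype) ≤
      MvPolynomial.homogeneousSubmodule (Fin 3) ℝ (l - 2) := by
    rintro _ ⟨p, rfl⟩
    exact polyLaplacian_isHomogeneous p.2
  have hzero : l < 2 → LinearMap.range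
      (polyLaplacian ∘ₗ (MvPolynomial.homogeneousSubmodule (Fin 3) ℝ l).subtype) = ⊥ := by
    intro hl'
    rw [LinearMap.range_eq_bot]
    ext1 p
    simp only [polyLaplacian, LinearMap.comp_apply, LinearMap.sum_apply, LinearMap.zero_apply]
    refine Finset.sum_eq_zero fun i _ => ?_
    have hp : (MvPolynomial.pderiv i (p : MvPolynomial (Fin 3) ℝ)).IsHomogeneous 0 := by
      have h0 : (MvPolynomial.pderiv i (p : MvPolynomial (Fin 3) ℝ)).IsHomogeneous (l - 1) :=
        MvPolynomial.IsHomogeneous.pderiv p.2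
      rwa [show l - 1 = 0 by omega] at h0
    have hC := MvPolynomial.totalDegree_eq_zero_iff_eq_C.1
      ((MvPolynomial.totalDegree_zero_iff_isHomogeneous _).2 hp)
    change MvPolynomial.pderiv i (MvPolynomial.pderiv i (p : MvPolynomial (Fin 3) ℝ)) = 0
    rw [hC, MvPolynomial.pderiv_C]
  have := hfin (l - 2)
  have hle := Submodule.finrank_mono hr
  have hl2 := finrank_homogeneous (l - 2)
  rcases l with _ | _ | l
  · rw [hzero (by omega), finrank_bot] at h
    omega
  · rw [hzero (by omega), finrank_bot] at h
    omega
  · simp only [Nat.add_sub_cancel, add_assoc, Nat.reduceAdd] at *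
    nlinarith

/-- Restriction of polynomials to the unit sphere, as elements of `L²(S)`. -/
def restrictL2 : MvPolynomial (Fin 3) ℝ →ₗ[ℝ] Lp ℝ 2 surf :=
  (ContinuousMap.toLp (E := ℝ) 2 surf ℝ).toLinearMap ∘ₗ
    { toFun := fun p => (⟨fun s => MvPolynomial.eval (fun i => (s : EuclideanSpace ℝ (Fin 3)) i) p,
        (MvPolynomial.continuous_eval p).comp (by fun_prop)⟩ : C(S2, ℝ))
      map_add' := fun p q => by ext s; simp
      map_smul' := fun a p => by ext s; simp }

lemma eval_smul_of_isHomogeneous {l : ℕ} {p : MvPolynomial (Fin 3) ℝ} (hp : p.IsHomogeneous l)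
    (c : ℝ) (x : Fin 3 → ℝ) :
    MvPolynomial.eval (fun i => c * x i) p = c ^ l * MvPolynomial.eval x p := by
  rw [MvPolynomial.eval_eq', MvPolynomial.eval_eq', Finset.mul_sum]
  refine Finset.sum_congr rfl fun e he => ?_
  have hdeg : ∑ i, e i = l := by
    rw [← Finsupp.degree_eq_sum]
    by_contra hne
    exact MvPolynomial.mem_support_iff.1 he (hp.coeff_eq_zero hne)
  simp only [mul_pow, Finset.prod_mul_distrib, Finset.prod_pow_eq_pow_sum, hdeg]
  ring

lemma restrictL2_injOn {l : ℕ} {p : MvPolynomial (Fin 3) ℝ} (hp : p.IsHomogeneous l)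
    (h : restrictL2 p = 0) : p = 0 := by
  have h1 := ContinuousMap.toLp_injective (p := 2) (𝕜 := ℝ) (E := ℝ) surf
    (h.trans (map_zero (ContinuousMap.toLp (E := ℝ) 2 surf ℝ)).symm)
  have hs : ∀ s : S2, MvPolynomial.eval (fun i => (s : EuclideanSpace ℝ (Fin 3)) i) p = 0 :=
    fun s => DFunLike.congr_fun h1 s
  refine hp.eq_zero_of_forall_eval_eq_zero fun x => ?_
  obtain ⟨y, c, hxy⟩ : ∃ y : S2, ∃ c : ℝ, x = fun i => c * (y : EuclideanSpace ℝ (Fin 3)) i := by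
    by_cases hx : WithLp.toLp 2 x = 0
    · obtain ⟨y, hy⟩ := exists_norm_eq (EuclideanSpace ℝ (Fin 3)) zero_le_one
      refine ⟨⟨y, by simpa using hy⟩, 0, ?_⟩
      have : x = 0 := by simpa using hx
      ext i; simp [this]
    · have hn : ‖WithLp.toLp 2 x‖ ≠ 0 := norm_ne_zero_iff.2 hx
      refine ⟨⟨‖WithLp.toLp 2 x‖⁻¹ • WithLp.toLp 2 x, ?_⟩, ‖WithLp.toLp 2 x‖, ?_⟩
      · rw [mem_sphere_zero_iff_norm, norm_smul, norm_inv, norm_norm, inv_mul_cancel₀ hn]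
      · ext i
        simp only [PiLp.smul_apply, smul_eq_mul]
        rw [mul_inv_cancel_left₀ hn]
  rw [hxy, eval_smul_of_isHomogeneous hp, hs y, mul_zero]

/-- For every degree there is an orthonormal family of spherical harmonics as required in
`IsSphericalHarmonics`. -/
theorem exists_isSphericalHarmonics : ∃ H, IsSphericalHarmonics H := by
  have key : ∀ l : ℕ, ∃ F : ℤ → C(S2, ℝ),
      (∀ m ∈ Finset.Icc (-l : ℤ) l, IsSphericalHarmonic l (F m)) ∧
      ∀ m ∈ Finset.Icc (-l : ℤ) l, ∀ m' ∈ Finset.Icc (-l : ℤ) l,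
        ∫ s, F m s * F m' s ∂surf = if m = m' then 1 else 0 := by
    intro l
    have hfin : Module.Finite ℝ (MvPolynomial.homogeneousSubmodule (Fin 3) ℝ l) :=
      Module.Finite.iff_fg.2 (MvPolynomial.homogeneousSubmodule_fg _ _ l)
    let T : harmonicPoly l →ₗ[ℝ] Lp ℝ 2 surf :=
      restrictL2 ∘ₗ (MvPolynomial.homogeneousSubmodule (Fin 3) ℝ l).subtype ∘ₗ
        (harmonicPoly l).subtype
    have hT : Function.Injective T := by
      intro p q hpq
      have hsub : restrictL2 ((p : MvPolynomial (Fin 3) ℝ) - (q : MvPolynomial (Fin 3) ℝ)) = 0 :=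
        (map_sub restrictL2 _ _).trans (sub_eq_zero.2 hpq)
      exact Subtype.ext (Subtype.ext (sub_eq_zero.1 (restrictL2_injOn (p.1.2.sub q.1.2) hsub)))
    have hrank : 2 * l + 1 ≤ Module.finrank ℝ (LinearMap.range T) := by
      rw [LinearMap.finrank_range_of_inj hT]
      exact finrank_harmonicPoly l
    let b := stdOrthonormalBasis ℝ (LinearMap.range T)
    have hex : ∀ i, ∃ f : C(S2, ℝ), IsSphericalHarmonic l f ∧
        ContinuousMap.toLp (E := ℝ) 2 surf ℝ f = (b i : Lp ℝ 2 surf) := by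
      intro i
      obtain ⟨p, hp⟩ := (b i).2
      exact ⟨_, ⟨p.1.1, p.1.2, p.2, fun s => rfl⟩, hp⟩
    choose f hf1 hf2 using hex
    let idx : ℤ → Fin (Module.finrank ℝ (LinearMap.range T)) := fun m =>
      ⟨min (m + l).toNat (2 * l), by omega⟩
    refine ⟨fun m => f (idx m), fun m _ => hf1 _, fun m hm m' hm' => ?_⟩
    have h1 := ContinuousMap.inner_toLp (μ := surf) (𝕜 := ℝ) (f (idx m')) (f (idx m))
    rw [hf2, hf2, ← Submodule.coe_inner, orthonormal_iff_ite.1 b.orthonormal] at h1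
    simp only [conj_trivial] at h1
    rw [← h1]
    rw [Finset.mem_Icc] at hm hm'
    refine if_congr ?_ rfl rfl
    rw [Fin.mk.injEq]
    omega
  choose H h1 h2 using key
  exact ⟨H, h1, h2⟩

/-! ### Truncation of the scattering operator -/

/-- The operator `v ↦ (v, h)_S h`, that is,
`(s, r) ↦ (∫_S v(s', r) h(s') ds') h(s)`, on `V`. -/
def harmonicProj {d : ℕ} (R : Set (EuclideanSpace ℝ (Fin d))) (h : C(S2, ℝ)) :
    V R →L[ℝ] V R :=
  angularOp ((h.comp ContinuousMap.fst) * (h.comp ContinuousMap.snd))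

theorem harmonicProj_ae {d : ℕ} (R : Set (EuclideanSpace ℝ (Fin d))) (h : C(S2, ℝ)) (v : V R) :
    harmonicProj R h v =ᵐ[phaseMeas R] fun p => (∫ s', v (s', p.2) * h s' ∂surf) * h p.1 := by
  filter_upwards [angularOp_ae ((h.comp ContinuousMap.fst) * (h.comp ContinuousMap.snd)) v]
    with p hp
  rw [harmonicProj, hp, ← integral_mul_const]
  refine integral_congr_ae (Filter.Eventually.of_forall fun s' => ?_)
  simp only [ContinuousMap.mul_apply, ContinuousMap.comp_apply, ContinuousMap.fst_apply,
    ContinuousMap.snd_apply]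
  ring

/-- The truncated scattering operator
`S_N v = ∑_{l ≤ N} g ^ l ∑_{-l ≤ m ≤ l} (v, H l m)_S H l m` on `V`. -/
def scatOpTrunc {d : ℕ} (R : Set (EuclideanSpace ℝ (Fin d))) (g : ℝ)
    (H : ℕ → ℤ → C(S2, ℝ)) (N : ℕ) : V R →L[ℝ] V R :=
  ∑ l ∈ Finset.range (N + 1), g ^ l • ∑ m ∈ Finset.Icc (-l : ℤ) l, harmonicProj R (H l m)

/-! ### The operators of the radiative transfer equation -/

/-- Attenuation `M v = σ_t v`, where `σ_t = σ_a + σ_s`. -/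
def attOp {d : ℕ} {R : Set (EuclideanSpace ℝ (Fin d))} (σa σs : Linf R) : V R →L[ℝ] V R :=
  mulOp (σa + σs)

/-- Scattering `K v = σ_s S v`. -/
def scatK {d : ℕ} {R : Set (EuclideanSpace ℝ (Fin d))} (σs : Linf R)
    (g : ℝ) (hg0 : 0 ≤ g) (hg1 : g < 1) : V R →L[ℝ] V R :=
  mulOp σs ∘L scatOp R g hg0 hg1

/-- Truncated scattering `K_N v = σ_s S_N v`. -/
def scatKTrunc {d : ℕ} {R : Set (EuclideanSpace ℝ (Fin d))} (σs : Linf R)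
    (g : ℝ) (H : ℕ → ℤ → C(S2, ℝ)) (N : ℕ) : V R →L[ℝ] V R :=
  mulOp σs ∘L scatOpTrunc R g H N

/-- The constant `c = ‖σ_s / σ_t‖_∞`, the essential supremum over `R`, where
`σ_t = σ_a + σ_s`. -/
def scatRatio {d : ℕ} {R : Set (EuclideanSpace ℝ (Fin d))} (σa σs : Linf R) : ℝ :=
  (eLpNorm (fun r => σs r / (σa r + σs r)) ⊤ (spaceMeas R)).toReal

end RadiativeTransfer

end

noncomputable section

namespace RadiativeTransfer

/-! ### Legendre polynomials and their generating function -/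

/-! All operators act separately on the slices `f = v(·, r)`, so the claim reduces to quadratic
forms on the sphere. Let `E_l` be the squared norm of the projection of `f` on the harmonics `H l m`
(`degreeEnergy`). Then `(S f, f) = ∑ g^l E_l` (`hasSum_degreeEnergy`), and `S_N` keeps the terms
with `l ≤ N`. The remainder is nonnegative, which is the upper bound. By Bessel's inequality it is
at most `g^(N+1) (‖f‖² - ∑_{l ≤ N} E_l)`; combined with `σ_s ≤ c σ_t` this gives the lower bound.
Since `(S_N f, f) ≤ ‖f‖²`, the form of `M - K_N` is bounded below by `γ ‖v‖²`, hence invertibility.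
Completeness of the spherical harmonics is never needed: the expansion of the form comes from that
of the kernel.

The kernel is expanded by the Legendre generating function (`hasSum_hgPhase`), uniformly because
`|P_n| ≤ 1` on `[-1, 1]`. To pass from `P_l(s · s')` to the `H l m` one needs the addition theorem
(`sum_harmonic_mul_harmonic`). It follows from the reproducing property of the zonal kernel
(`integral_zonalKernel_mul`): against a harmonic of degree `l`, orthogonality of degrees leaves only
the degree-`l` term of the Henyey–Greenstein kernel with parameter `a`, and that kernel is an
approximate identity as `a → 1`. -/

/-- The values `P_n(t)` of the Legendre polynomials, defined by Bonnet's recursion. -/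
def legendre (t : ℝ) : ℕ → ℝ
  | 0 => 1
  | 1 => t
  | n + 2 => ((2 * n + 3) * t * legendre t (n + 1) - (n + 1) * legendre t n) / (n + 2)

lemma legendre_rec (t : ℝ) (n : ℕ) :
    (n + 2) * legendre t (n + 2) =
      (2 * n + 3) * t * legendre t (n + 1) - (n + 1) * legendre t n := by
  rw [legendre]
  field_simp

/-- The Taylor coefficients of `(1 - x) ^ (-1 / 2)`. -/
def invSqrtCoeff (j : ℕ) : ℝ := Nat.centralBinom j / 4 ^ j

lemma invSqrtCoeff_nonneg (j : ℕ) : 0 ≤ invSqrtCoeff j := by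
  unfold invSqrtCoeff; positivity

/-- Coefficient form of the equation `2 (1 - x) y' = y` satisfied by `(1 - x)^(-1/2)`. -/
lemma invSqrtCoeff_succ (j : ℕ) :
    2 * (j + 1) * invSqrtCoeff (j + 1) = (2 * j + 1) * invSqrtCoeff j := by
  have h : ((j : ℝ) + 1) * (Nat.centralBinom (j + 1)) = 2 * (2 * j + 1) * Nat.centralBinom j := by
    exact_mod_cast Nat.succ_mul_centralBinom_succ j
  unfold invSqrtCoeff
  rw [pow_succ]
  field_simp
  linear_combination 2 * h

open PowerSeries in
/-- The power series of `(1 - w X) ^ (-1 / 2)`. -/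
def invSqrtSeries (w : ℂ) : PowerSeries ℂ :=
  PowerSeries.mk fun j => (invSqrtCoeff j : ℂ) * w ^ j

open PowerSeries in
lemma invSqrtSeries_deriv (w : ℂ) :
    2 * (1 - C w * X) * derivative ℂ (invSqrtSeries w) = C w * invSqrtSeries w := by
  have hc : ∀ j : ℕ, 2 * ((j : ℂ) + 1) * invSqrtCoeff (j + 1) = (2 * j + 1) * invSqrtCoeff j := by
    intro j
    exact_mod_cast congrArg (fun x : ℝ => (x : ℂ)) (invSqrtCoeff_succ j)
  have e : 2 * (1 - C w * X) * derivative ℂ (invSqrtSeries w) =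
      C 2 * derivative ℂ (invSqrtSeries w)
        - C (2 * w) * (X * derivative ℂ (invSqrtSeries w)) := by
    rw [map_mul]
    have : (C (2 : ℂ) : PowerSeries ℂ) = 2 := map_ofNat _ 2
    rw [this]; ring
  rw [e]
  ext n
  rcases n with _ | n
  · simp only [map_sub, coeff_C_mul, coeff_zero_X_mul, coeff_derivative, invSqrtSeries, coeff_mk]
    have := hc 0
    push_cast at *
    linear_combination w * this
  · simp only [map_sub, coeff_C_mul, coeff_succ_X_mul, coeff_derivative, invSqrtSeries, coeff_mk]
    have := hc (n + 1)
    push_cast at *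
    linear_combination w ^ (n + 2) * this

-- The product is formally `(1 - 2tX + X²)^(-1/2)`. The first-order equations of the two factors
-- combine to `(1 - 2tX + X²) G' = (t - X) G`, whose coefficients obey Bonnet's recursion.
open PowerSeries in
lemma coeff_invSqrtSeries_mul {w z : ℂ} {t : ℝ} (hwz : w * z = 1) (hsum : w + z = 2 * t) (n : ℕ) :
    coeff n (invSqrtSeries w * invSqrtSeries z) = legendre t n := by
  set G := invSqrtSeries w * invSqrtSeries z with hG
  have hC2 : (C (2 : ℂ) : PowerSeries ℂ) = 2 := map_ofNat _ 2
  have hCwz : (C w * C z : PowerSeries ℂ) = 1 := by rw [← map_mul, hwz, map_one]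
  have hCs : (C w + C z : PowerSeries ℂ) = 2 * C (t : ℂ) := by
    rw [← map_add, hsum, map_mul, hC2]
  have hode : derivative ℂ G - C (2 * t : ℂ) * (X * derivative ℂ G) + X * (X * derivative ℂ G) =
      C (t : ℂ) * G - X * G := by
    have h2 : (2 : PowerSeries ℂ) ≠ 0 := by
      rw [← hC2]; simp
    refine mul_left_cancel₀ h2 ?_
    have hd : derivative ℂ G = invSqrtSeries w * derivative ℂ (invSqrtSeries z) +
        invSqrtSeries z * derivative ℂ (invSqrtSeries w) := by
      rw [hG, Derivation.leibniz, smul_eq_mul, smul_eq_mul]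
    have hfac : (1 : PowerSeries ℂ) - 2 * C (t : ℂ) * X + X * X = (1 - C w * X) * (1 - C z * X) := by
      linear_combination (-X * X) * hCwz + X * hCs
    have h1 := invSqrtSeries_deriv w
    have h3 := invSqrtSeries_deriv z
    have hC2t : (C (2 * t : ℂ) : PowerSeries ℂ) = 2 * C (t : ℂ) := by rw [map_mul, hC2]
    rw [hC2t]
    calc _ = 2 * ((1 - 2 * C (t : ℂ) * X + X * X) * derivative ℂ G) := by ring
      _ = (1 - C w * X) * invSqrtSeries w * (2 * (1 - C z * X) * derivative ℂ (invSqrtSeries z)) +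
          (1 - C z * X) * invSqrtSeries z *
            (2 * (1 - C w * X) * derivative ℂ (invSqrtSeries w)) := by rw [hfac, hd]; ring
      _ = _ := by
        rw [h1, h3, hG]
        linear_combination (invSqrtSeries w * invSqrtSeries z) * (hCs - 2 * X * hCwz)
  have hcoeff : ∀ m, coeff m (derivative ℂ G - C (2 * t : ℂ) * (X * derivative ℂ G) +
      X * (X * derivative ℂ G)) = coeff m (C (t : ℂ) * G - X * G) := fun m => by rw [hode]
  have h0 : coeff 0 G = 1 := by
    simp [hG, invSqrtSeries, invSqrtCoeff, coeff_mul]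
  have h1 : coeff 1 G = t := by
    have := hcoeff 0
    simp only [map_sub, map_add, coeff_C_mul, coeff_zero_X_mul, coeff_derivative, h0] at this
    push_cast at this
    linear_combination this
  induction n using Nat.twoStepInduction with
  | zero => simp [h0, legendre]
  | one => simp [h1, legendre]
  | more n ih0 ih1 =>
    have hL := congrArg (fun x : ℝ => (x : ℂ)) (legendre_rec t n)
    push_cast at hL
    have hn : ((n : ℂ) + 2) ≠ 0 := by exact_mod_cast (by omega : n + 2 ≠ 0)
    refine mul_left_cancel₀ hn ?_
    rw [hL, ← ih0, ← ih1]
    have := hcoeff (n + 1)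
    -- The twice shifted term `X * (X * G')` contributes nothing to the coefficient of `X`, so that
    -- index is separate.
    rcases n with _ | n
    · simp only [map_sub, map_add, coeff_C_mul, coeff_succ_X_mul, coeff_derivative, zero_add,
        coeff_zero_X_mul] at this
      push_cast at *
      linear_combination this
    · simp only [map_sub, map_add, coeff_C_mul, coeff_succ_X_mul, coeff_derivative] at this
      push_cast at *
      linear_combination this

lemma legendre_one (n : ℕ) : legendre 1 n = 1 := by
  induction n using Nat.twoStepInduction with
  | zero => rfl
  | one => rfl
  | more n ih0 ih1 =>
    rw [legendre, ih0, ih1]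
    field_simp
    ring

/-- For `w = z = 1` the product series is `1 / (1 - X)`. -/
lemma sum_invSqrtCoeff_mul (n : ℕ) :
    ∑ p ∈ Finset.HasAntidiagonal.antidiagonal n, invSqrtCoeff p.1 * invSqrtCoeff p.2 = 1 := by
  have h := coeff_invSqrtSeries_mul (w := 1) (z := 1) (t := 1) (by simp) (by norm_num) n
  rw [legendre_one, PowerSeries.coeff_mul] at h
  simp only [invSqrtSeries, PowerSeries.coeff_mk, one_pow, mul_one] at h
  exact_mod_cast h

/-- For `t = cos θ` take `w, z = e^{±iθ}`. Since the coefficients of `invSqrtSeries 1` are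
nonnegative and `|w| = |z| = 1`, the triangle inequality bounds `|P_n(t)|` by `P_n(1) = 1`. -/
lemma abs_legendre_le_one {t : ℝ} (ht : |t| ≤ 1) (n : ℕ) : |legendre t n| ≤ 1 := by
  have ht2 : 0 ≤ 1 - t ^ 2 := by
    have := (sq_le_one_iff_abs_le_one t).2 ht
    linarith
  set w : ℂ := ⟨t, √(1 - t ^ 2)⟩ with hw
  set z : ℂ := ⟨t, -√(1 - t ^ 2)⟩ with hz
  have hs := Real.mul_self_sqrt ht2
  have hwz : w * z = 1 := by
    apply Complex.ext
    · simp only [hw, hz, Complex.mul_re, Complex.one_re]; linear_combination hs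
    · simp only [hw, hz, Complex.mul_im, Complex.one_im]; ring
  have hsum : w + z = 2 * t := by
    apply Complex.ext
    · simp [hw, hz]; ring
    · simp [hw, hz]
  have hnw : ‖w‖ = 1 := by
    rw [Complex.norm_def, Complex.normSq_apply, Real.sqrt_eq_one]
    simp only [hw]; linear_combination hs
  have hnz : ‖z‖ = 1 := by
    rw [Complex.norm_def, Complex.normSq_apply, Real.sqrt_eq_one]
    simp only [hz]; linear_combination hs
  have h := coeff_invSqrtSeries_mul hwz hsum n
  have h2 : ‖((legendre t n : ℝ) : ℂ)‖ ≤ 1 := by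
    rw [← h, PowerSeries.coeff_mul, ← sum_invSqrtCoeff_mul n]
    refine (norm_sum_le _ _).trans (le_of_eq (Finset.sum_congr rfl fun p _ => ?_))
    simp only [invSqrtSeries, PowerSeries.coeff_mk, norm_mul, norm_pow, hnw, hnz, one_pow, mul_one,
      Complex.norm_real, Real.norm_of_nonneg (invSqrtCoeff_nonneg _)]
  simpa using h2

lemma summable_legendre_deriv_bound {r : ℝ} (hr0 : 0 ≤ r) (hr : r < 1) :
    Summable fun n : ℕ => (n : ℝ) * r ^ (n - 1) := by
  have h := summable_pow_mul_geometric_of_norm_lt_one 1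
    (r := r) (by rwa [Real.norm_of_nonneg hr0])
  have h0 := summable_geometric_of_lt_one hr0 hr
  refine (summable_nat_add_iff 1).1 ((h.add h0).congr fun n => ?_)
  simp only [Nat.add_sub_cancel]; push_cast; ring

lemma summable_legendre {t a : ℝ} (ht : |t| ≤ 1) (ha : |a| < 1) :
    Summable fun n : ℕ => legendre t n * a ^ n := by
  refine Summable.of_norm_bounded (summable_geometric_of_lt_one (abs_nonneg a) ha) fun n => ?_
  rw [norm_mul, norm_pow, Real.norm_eq_abs, Real.norm_eq_abs]
  exact mul_le_of_le_one_left (by positivity) (abs_legendre_le_one ht n)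

lemma hasDerivAt_legendre_tsum {t a : ℝ} (ht : |t| ≤ 1) (ha : |a| < 1) :
    HasDerivAt (fun x => ∑' n : ℕ, legendre t n * x ^ n)
      (∑' n : ℕ, legendre t n * (n * a ^ (n - 1))) a := by
  obtain ⟨r, har, hr⟩ := exists_between ha
  have hr0 : 0 ≤ r := (abs_nonneg a).trans har.le
  refine hasDerivAt_tsum_of_isPreconnected (summable_legendre_deriv_bound hr0 hr)
    (t := Metric.ball 0 r) Metric.isOpen_ball (convex_ball _ _).isPreconnected
    (fun n y _ => (hasDerivAt_pow n y).const_mul (legendre t n)) (fun n y hy => ?_)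
    (y₀ := 0) (Metric.mem_ball_self ((abs_nonneg a).trans_lt har)) ?_ (by simpa using har)
  · rw [mem_ball_zero_iff] at hy
    rw [norm_mul, norm_mul, norm_pow, Real.norm_natCast, Real.norm_eq_abs]
    refine (mul_le_of_le_one_left (by positivity) (abs_legendre_le_one ht n)).trans ?_
    gcongr
  · exact summable_legendre ht (by simp)

/-- Bonnet's recursion times `a^(n+1)`, summed over `n`; `h1` to `h4` evaluate the shifted series
that occur. -/
lemma legendre_gen_ode {t a : ℝ} (ht : |t| ≤ 1) (ha : |a| < 1) :
    (1 - 2 * a * t + a ^ 2) * (∑' n : ℕ, legendre t n * (n * a ^ (n - 1))) =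
      (t - a) * ∑' n : ℕ, legendre t n * a ^ n := by
  have hs := (summable_legendre ht ha).hasSum
  have hs' : Summable fun n : ℕ => legendre t n * (n * a ^ (n - 1)) := by
    refine Summable.of_norm_bounded (summable_legendre_deriv_bound (abs_nonneg a) ha) fun n => ?_
    rw [norm_mul, norm_mul, norm_pow, Real.norm_natCast, Real.norm_eq_abs, Real.norm_eq_abs]
    exact mul_le_of_le_one_left (by positivity) (abs_legendre_le_one ht n)
  have hd := hs'.hasSum
  set f := ∑' n : ℕ, legendre t n * a ^ n
  set f' := ∑' n : ℕ, legendre t n * (n * a ^ (n - 1))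
  have h1 : HasSum (fun n : ℕ => legendre t (n + 2) * ((n + 2) * a ^ (n + 1))) (f' - t) := by
    have := (hasSum_nat_add_iff' 2).2 hd
    simpa [Finset.sum_range_succ, legendre] using this
  have h2 : HasSum (fun n : ℕ => legendre t (n + 1) * ((n + 1) * a ^ n)) f' := by
    have := (hasSum_nat_add_iff' 1).2 hd
    simpa [Finset.sum_range_succ, legendre] using this
  have h3 : HasSum (fun n : ℕ => legendre t (n + 1) * a ^ (n + 1)) (f - 1) := by
    have := (hasSum_nat_add_iff' 1).2 hs
    simpa [Finset.sum_range_succ, legendre] using this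
  have h4 : HasSum (fun n : ℕ => legendre t n * (n * a ^ n)) (a * f') := by
    refine (hd.mul_left a).congr_fun fun n => ?_
    rcases n with _ | n
    · simp
    · simp only [Nat.add_sub_cancel]; ring
  have h5 := ((((h2.mul_left (2 * a)).add h3).mul_left t).sub ((h4.add hs).mul_left a)).sub h1
  have h6 : HasSum (fun _ : ℕ => (0 : ℝ)) (t * (2 * a * f' + (f - 1)) - a * (a * f' + f) - (f' - t)) := by
    refine h5.congr_fun fun n => ?_
    have := legendre_rec t n
    linear_combination a ^ (n + 1) * this
  have := h6.unique hasSum_zero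
  linear_combination -this

lemma legendre_denom_pos {t a : ℝ} (ht : |t| ≤ 1) (ha : |a| < 1) :
    0 < 1 - 2 * a * t + a ^ 2 := by
  have h1 := abs_le.1 ht
  have h2 := abs_lt.1 ha
  have h3 : 0 < 1 - a ^ 2 := by nlinarith
  nlinarith [sq_nonneg (t - a), sq_nonneg t]

/-- The generating function of the Legendre polynomials. -/
lemma legendre_gen {t a : ℝ} (ht : |t| ≤ 1) (ha : |a| < 1) :
    (∑' n : ℕ, legendre t n * a ^ n) * √(1 - 2 * a * t + a ^ 2) = 1 := by
  -- By `legendre_gen_ode` the product has zero derivative on the unit ball, hence equals its value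
  -- `1` at the origin.
  have hder : ∀ x ∈ Metric.ball (0 : ℝ) 1, HasDerivAt
      (fun x => (∑' n : ℕ, legendre t n * x ^ n) * √(1 - 2 * x * t + x ^ 2)) 0 x := by
    intro x hx
    have hx' : |x| < 1 := by simpa using hx
    have hD := legendre_denom_pos ht hx'
    have h1 : HasDerivAt (fun x : ℝ => 1 - 2 * x * t + x ^ 2) (-2 * t + 2 * x) x := by
      have := (((hasDerivAt_id x).const_mul 2).mul_const t).const_sub 1 |>.add (hasDerivAt_pow 2 x)
      refine this.congr_deriv ?_
      simp
    refine ((hasDerivAt_legendre_tsum ht hx').mul (h1.sqrt hD.ne')).congr_deriv ?_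
    have hode := legendre_gen_ode ht hx'
    have hq := Real.sqrt_pos.2 hD
    have hsq := Real.mul_self_sqrt hD.le
    set q := √(1 - 2 * x * t + x ^ 2)
    rw [← hsq] at hode
    rw [show ∀ A B : ℝ, A * q + B * ((-2 * t + 2 * x) / (2 * q)) =
      (q * q * A - (t - x) * B) / q by intro A B; field_simp; ring, hode, sub_self, zero_div]
  have := IsOpen.is_const_of_deriv_eq_zero (𝕜 := ℝ) Metric.isOpen_ball
    (convex_ball (0 : ℝ) 1).isPreconnected
    (fun x hx => (hder x hx).differentiableAt.differentiableWithinAt)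
    (fun x hx => (hder x hx).deriv) (x := a) (y := 0) (by simpa using ha) (by simp)
  rw [this, tsum_eq_single 0 (by intro n hn; simp [hn])]
  simp [legendre]

/-- The expansion of the Henyey–Greenstein phase function in Legendre polynomials. -/
theorem hasSum_hgPhase {t a : ℝ} (ht : |t| ≤ 1) (ha : |a| < 1) :
    HasSum (fun n : ℕ => a ^ n * ((2 * n + 1) / (4 * Real.pi) * legendre t n)) (hgPhase a t) := by
  have hs := (summable_legendre ht ha).hasSum
  have hd : Summable fun n : ℕ => legendre t n * (n * a ^ (n - 1)) := by
    refine Summable.of_norm_bounded (summable_legendre_deriv_bound (abs_nonneg a) ha) fun n => ?_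
    rw [norm_mul, norm_mul, norm_pow, Real.norm_natCast, Real.norm_eq_abs, Real.norm_eq_abs]
    exact mul_le_of_le_one_left (by positivity) (abs_legendre_le_one ht n)
  have hD := legendre_denom_pos ht ha
  have hq := Real.sqrt_pos.2 hD
  have hsq := Real.mul_self_sqrt hD.le
  have hode := legendre_gen_ode ht ha
  have hgen := legendre_gen ht ha
  -- The operator `2a d/da + 1` multiplies the `n`-th term by `2n + 1`. With `D = 1 - 2at + a²` it
  -- turns `D^(-1/2)` into `(1 - a²) D^(-3/2)`.
  have h := ((hd.hasSum.mul_left (2 * a)).add hs).mul_left (1 / (4 * Real.pi))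
  have hpow : (1 - 2 * a * t + a ^ 2) ^ (3 / 2 : ℝ) =
      (1 - 2 * a * t + a ^ 2) * √(1 - 2 * a * t + a ^ 2) := by
    rw [Real.sqrt_eq_rpow, show (3 / 2 : ℝ) = 1 + 1 / 2 by norm_num, Real.rpow_add hD, Real.rpow_one]
  have hval : hgPhase a t = 1 / (4 * Real.pi) *
      (2 * a * (∑' n : ℕ, legendre t n * (n * a ^ (n - 1))) + ∑' n : ℕ, legendre t n * a ^ n) := by
    unfold hgPhase
    rw [hpow]
    congr 1
    rw [div_eq_iff (by positivity)]
    set q := √(1 - 2 * a * t + a ^ 2)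
    linear_combination (-2 * a * q) * hode - (1 - 2 * a * t + a ^ 2 + 2 * a * (t - a)) * hgen
  rw [hval]
  refine h.congr_fun fun n => ?_
  rcases n with _ | n
  · simp
  · simp only [Nat.add_sub_cancel]; push_cast; ring

/-! ### Zonal harmonics -/

section Zonal

open MvPolynomial

lemma polyLaplacian_apply (p : MvPolynomial (Fin 3) ℝ) :
    polyLaplacian p = ∑ i, pderiv i (pderiv i p) := by
  simp [polyLaplacian]

/-- The linear form `x ↦ s · x`. -/
def linearForm (s : Fin 3 → ℝ) : MvPolynomial (Fin 3) ℝ := ∑ i, C (s i) * X i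

/-- The quadratic form `x ↦ |x|²`. -/
def normSqPoly : MvPolynomial (Fin 3) ℝ := ∑ i, X i ^ 2

/-- The derivative of a polynomial in the direction `s`. -/
def dirDeriv (s : Fin 3 → ℝ) (p : MvPolynomial (Fin 3) ℝ) : MvPolynomial (Fin 3) ℝ :=
  ∑ i, C (s i) * pderiv i p

/-- The solid zonal harmonics with pole `s`, homogenized Legendre polynomials. -/
def zonal (s : Fin 3 → ℝ) : ℕ → MvPolynomial (Fin 3) ℝ
  | 0 => 1
  | 1 => linearForm s
  | n + 2 => C (1 / (n + 2) : ℝ) * (C (2 * n + 3 : ℝ) * (linearForm s * zonal s (n + 1)) -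
      C (n + 1 : ℝ) * (normSqPoly * zonal s n))

lemma zonal_rec (s : Fin 3 → ℝ) (n : ℕ) :
    C (n + 2 : ℝ) * zonal s (n + 2) = C (2 * n + 3 : ℝ) * (linearForm s * zonal s (n + 1)) -
      C (n + 1 : ℝ) * (normSqPoly * zonal s n) := by
  rw [zonal, ← mul_assoc, ← C_mul, mul_one_div_cancel (by positivity), C_1, one_mul]

lemma linearForm_isHomogeneous (s : Fin 3 → ℝ) : (linearForm s).IsHomogeneous 1 :=
  IsHomogeneous.sum _ _ _ fun i _ => by
    simpa using (isHomogeneous_C (Fin 3) (s i)).mul (isHomogeneous_X ℝ i)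

lemma normSqPoly_isHomogeneous : normSqPoly.IsHomogeneous 2 :=
  IsHomogeneous.sum _ _ _ fun i _ => isHomogeneous_X_pow i 2

lemma zonal_isHomogeneous (s : Fin 3 → ℝ) (n : ℕ) : (zonal s n).IsHomogeneous n := by
  induction n using Nat.twoStepInduction with
  | zero => exact isHomogeneous_one _ _
  | one => exact linearForm_isHomogeneous s
  | more n ih0 ih1 =>
    have h1 := ((linearForm_isHomogeneous s).mul ih1).C_mul (2 * n + 3 : ℝ)
    have h2 := (normSqPoly_isHomogeneous.mul ih0).C_mul (n + 1 : ℝ)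
    rw [show 1 + (n + 1) = n + 2 by ring] at h1
    rw [show 2 + n = n + 2 by ring] at h2
    exact (h1.sub h2).C_mul _

lemma polyLaplacian_linearForm_mul (s : Fin 3 → ℝ) (p : MvPolynomial (Fin 3) ℝ) :
    polyLaplacian (linearForm s * p) =
      C 2 * dirDeriv s p + linearForm s * polyLaplacian p := by
  have h2 : (C 2 : MvPolynomial (Fin 3) ℝ) = 2 := map_ofNat _ 2
  simp only [polyLaplacian_apply, linearForm, dirDeriv, Fin.sum_univ_three, Derivation.leibniz,
    map_add, smul_eq_mul, pderiv_C, pderiv_X, Pi.single_apply, h2]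
  simp
  ring

/-- `Δ|x|² = 6`, and Euler's identity turns the cross term `4 x · ∇p` into `4n p`. -/
lemma polyLaplacian_normSqPoly_mul {n : ℕ} {p : MvPolynomial (Fin 3) ℝ} (hp : p.IsHomogeneous n) :
    polyLaplacian (normSqPoly * p) =
      C (4 * n + 6 : ℝ) * p + normSqPoly * polyLaplacian p := by
  have he := hp.sum_X_mul_pderiv
  rw [Fin.sum_univ_three, nsmul_eq_mul] at he
  have hC : (C (4 * n + 6 : ℝ) : MvPolynomial (Fin 3) ℝ) = 4 * n + 6 := by
    simp only [map_add, map_mul, map_natCast, map_ofNat]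
  rw [hC]
  have h4 : (4 * (n : MvPolynomial (Fin 3) ℝ) + 6) * p = 4 * ((n : MvPolynomial (Fin 3) ℝ) * p) + 6 * p := by
    ring
  rw [h4, ← he]
  simp only [polyLaplacian_apply, normSqPoly, pow_two, Fin.sum_univ_three, Derivation.leibniz,
    map_add, smul_eq_mul, pderiv_X, Pi.single_apply]
  simp
  ring

lemma dirDeriv_mul (s : Fin 3 → ℝ) (p q : MvPolynomial (Fin 3) ℝ) :
    dirDeriv s (p * q) = p * dirDeriv s q + q * dirDeriv s p := by
  simp only [dirDeriv, Derivation.leibniz, smul_eq_mul, Fin.sum_univ_three]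
  ring

lemma dirDeriv_C_mul (s : Fin 3 → ℝ) (a : ℝ) (q : MvPolynomial (Fin 3) ℝ) :
    dirDeriv s (C a * q) = C a * dirDeriv s q := by
  rw [dirDeriv_mul]
  simp [dirDeriv]

lemma dirDeriv_sub (s : Fin 3 → ℝ) (p q : MvPolynomial (Fin 3) ℝ) :
    dirDeriv s (p - q) = dirDeriv s p - dirDeriv s q := by
  simp only [dirDeriv, map_sub, Fin.sum_univ_three]
  ring

lemma polyLaplacian_C_mul (a : ℝ) (q : MvPolynomial (Fin 3) ℝ) :
    polyLaplacian (C a * q) = C a * polyLaplacian q := by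
  rw [C_mul', C_mul', map_smul]

lemma dirDeriv_linearForm {s : Fin 3 → ℝ} (hs : ∑ i, s i ^ 2 = 1) :
    dirDeriv s (linearForm s) = 1 := by
  rw [← C_1, ← hs]
  simp only [dirDeriv, linearForm, Fin.sum_univ_three, map_add, Derivation.leibniz, pderiv_C,
    pderiv_X, Pi.single_apply, smul_eq_mul, C_pow]
  simp
  ring

lemma dirDeriv_normSqPoly (s : Fin 3 → ℝ) :
    dirDeriv s normSqPoly = 2 * linearForm s := by
  simp only [dirDeriv, linearForm, normSqPoly, Fin.sum_univ_three, map_add, Derivation.leibniz_pow,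
    pderiv_X, Pi.single_apply, smul_eq_mul]
  simp
  ring

lemma C_mul_left_cancel {a : ℝ} (ha : a ≠ 0) {p q : MvPolynomial (Fin 3) ℝ}
    (h : C a * p = C a * q) : p = q :=
  mul_left_cancel₀ (by simpa using ha) h

/-- The Laplacian of the recursion produces `2 (2n + 3) ∂_s Z_{n+1} - (n + 1)(4n + 6) Z_n`, which
cancels exactly when `∂_s Z_{n+1} = (n + 1) Z_n`. So harmonicity and the derivative formula are
proved together, for two consecutive degrees. At `n = 0` the truncated index `n - 1` is harmless,
its coefficient being `0`. -/
lemma zonal_harmonic_and_dirDeriv {s : Fin 3 → ℝ} (hs : ∑ i, s i ^ 2 = 1) (n : ℕ) :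
    (polyLaplacian (zonal s n) = 0 ∧ dirDeriv s (zonal s n) = C (n : ℝ) * zonal s (n - 1)) ∧
    (polyLaplacian (zonal s (n + 1)) = 0 ∧
      dirDeriv s (zonal s (n + 1)) = C (n + 1 : ℝ) * zonal s n) := by
  induction n with
  | zero =>
    have h0 : polyLaplacian (1 : MvPolynomial (Fin 3) ℝ) = 0 := by simp [polyLaplacian_apply]
    have h1 : dirDeriv s (1 : MvPolynomial (Fin 3) ℝ) = 0 := by simp [dirDeriv]
    refine ⟨⟨h0, by simp [zonal, h1]⟩, ?_, ?_⟩
    · have := polyLaplacian_linearForm_mul s 1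
      rw [h0, h1, mul_one] at this
      simpa [zonal] using this
    · simpa [zonal] using dirDeriv_linearForm hs
  | succ n ih =>
    obtain ⟨⟨hL0, hd0⟩, hL1, hd1⟩ := ih
    have hd1' : dirDeriv s (zonal s (n + 1)) = C ((n + 1 : ℕ) : ℝ) * zonal s (n + 1 - 1) := by
      rw [hd1]; simp
    refine ⟨⟨hL1, hd1'⟩, ?_, ?_⟩
    · refine C_mul_left_cancel (a := n + 2) (by positivity) ?_
      rw [← polyLaplacian_C_mul, zonal_rec, map_sub, polyLaplacian_C_mul, polyLaplacian_C_mul,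
        polyLaplacian_linearForm_mul, polyLaplacian_normSqPoly_mul (zonal_isHomogeneous s n),
        hL0, hL1, hd1]
      simp only [map_add, map_mul, map_natCast, map_ofNat, map_one, mul_zero, add_zero]
      ring
    · refine C_mul_left_cancel (a := n + 2) (by positivity) ?_
      rw [← dirDeriv_C_mul, zonal_rec, dirDeriv_sub, dirDeriv_C_mul, dirDeriv_C_mul,
        dirDeriv_mul, dirDeriv_mul, hd1, hd0, dirDeriv_linearForm hs, dirDeriv_normSqPoly]
      rcases n with _ | n
      · simp only [zonal, map_add, map_mul, map_natCast, map_ofNat, map_one, Nat.cast_zero, map_zero]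
        ring
      · have := zonal_rec s n
        simp only [map_add, map_mul, map_natCast, map_ofNat, map_one, Nat.add_sub_cancel] at this ⊢
        push_cast at this ⊢
        linear_combination (-(n : MvPolynomial (Fin 3) ℝ) - 2) * this

lemma polyLaplacian_zonal {s : Fin 3 → ℝ} (hs : ∑ i, s i ^ 2 = 1) (n : ℕ) :
    polyLaplacian (zonal s n) = 0 :=
  (zonal_harmonic_and_dirDeriv hs n).1.1

lemma eval_zonal (s : Fin 3 → ℝ) {x : Fin 3 → ℝ} (hx : ∑ i, x i ^ 2 = 1) (n : ℕ) :
    eval x (zonal s n) = legendre (∑ i, s i * x i) n := by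
  induction n using Nat.twoStepInduction with
  | zero => simp [zonal, legendre]
  | one => simp [zonal, legendre, linearForm]
  | more n ih0 ih1 =>
    have hq : eval x normSqPoly = 1 := by simpa [normSqPoly] using hx
    have hu : eval x (linearForm s) = ∑ i, s i * x i := by simp [linearForm]
    rw [zonal, legendre]
    simp only [map_mul, map_sub, eval_C, ih0, ih1, hq, hu]
    ring

end Zonal

/-! ### Orthogonality of spherical harmonics of different degrees -/

section Orthogonality

open MvPolynomial Set

/-- Three-dimensional Euclidean space. -/
local notation "E3" => EuclideanSpace ℝ (Fin 3)

/-- Evaluation of a polynomial at a point of Euclidean space. -/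
def evalAt (p : MvPolynomial (Fin 3) ℝ) (x : E3) : ℝ := eval (fun i => x i) p

lemma continuous_evalAt (p : MvPolynomial (Fin 3) ℝ) : Continuous (evalAt p) :=
  (continuous_eval p).comp (by fun_prop)

lemma hasLineDerivAt_evalAt (p : MvPolynomial (Fin 3) ℝ) (x : E3) (i : Fin 3) :
    HasLineDerivAt ℝ (evalAt p) (evalAt (pderiv i p) x) x (EuclideanSpace.single i 1) := by
  unfold HasLineDerivAt evalAt
  induction p using MvPolynomial.induction_on with
  | C a => simpa using hasDerivAt_const (0 : ℝ) a
  | add p q hp hq =>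
    refine ((hp.add hq).congr_deriv (by simp)).congr_of_eventuallyEq
      (Filter.Eventually.of_forall fun t => ?_)
    simp
  | mul_X p j hp =>
    have hx : HasDerivAt (fun t : ℝ => (x + t • EuclideanSpace.single i (1 : ℝ)) j)
        (if i = j then 1 else 0) 0 := by
      have := ((hasDerivAt_id (0 : ℝ)).mul_const
        ((EuclideanSpace.single i (1 : ℝ) : E3) j)).const_add (x j)
      refine (this.congr_deriv ?_).congr_of_eventuallyEq (Filter.Eventually.of_forall fun t => ?_)
      · simp [eq_comm]
      · simp
    have := hp.mul hx
    refine (this.congr_deriv ?_).congr_of_eventuallyEq (Filter.Eventually.of_forall fun t => ?_)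
    · simp only [zero_smul, add_zero, Derivation.leibniz, pderiv_X, smul_eq_mul, map_add, map_mul,
        eval_X, Pi.single_apply]
      rcases eq_or_ne i j with h | h
      · simp [h]; ring
      · simp [h, h.symm]; ring
    · simp

/-- Squaring removes the kink of the positive part. Thus `cutoff ^ 2` is differentiable everywhere,
and integration by parts over the whole space has no boundary term. -/
lemma hasDerivAt_max_zero_sq (y : ℝ) :
    HasDerivAt (fun y : ℝ => max 0 y ^ 2) (2 * max 0 y) y := by
  rcases lt_trichotomy y 0 with h | h | h
  · rw [max_eq_left h.le, mul_zero]
    refine (hasDerivAt_const y (0 : ℝ)).congr_of_eventuallyEq ?_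
    filter_upwards [gt_mem_nhds h] with z hz
    rw [max_eq_left hz.le]; simp
  · subst h
    rw [hasDerivAt_iff_isLittleO_nhds_zero]
    refine (Asymptotics.IsBigO.of_bound 1 (Filter.Eventually.of_forall fun z => ?_)).trans_isLittleO
      (Asymptotics.isLittleO_pow_id (one_lt_two))
    rw [one_mul, Real.norm_eq_abs, Real.norm_eq_abs]
    rcases le_total z 0 with hz | hz
    · simp [hz, sq_nonneg]
    · simp [hz]
  · rw [max_eq_right h.le]
    have := hasDerivAt_pow 2 y
    refine (this.congr_deriv (by simp)).congr_of_eventuallyEq ?_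
    filter_upwards [lt_mem_nhds h] with z hz
    rw [max_eq_right hz.le]

/-- The cutoff function `(1 - |x|²)₊`. -/
def cutoff (x : E3) : ℝ := max 0 (1 - ‖x‖ ^ 2)

lemma continuous_cutoff : Continuous cutoff := by unfold cutoff; fun_prop

lemma cutoff_eq_zero {x : E3} (hx : x ∉ Metric.closedBall (0 : E3) 1) : cutoff x = 0 := by
  have : 1 < ‖x‖ := by simpa using hx
  exact max_eq_left (by nlinarith)

lemma hasLineDerivAt_cutoff_sq (x : E3) (i : Fin 3) :
    HasLineDerivAt ℝ (fun x => cutoff x ^ 2) (-4 * (x i * cutoff x)) x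
      (EuclideanSpace.single i 1) := by
  unfold HasLineDerivAt cutoff
  have hn : HasDerivAt (fun t : ℝ => 1 - ‖x + t • EuclideanSpace.single i (1 : ℝ)‖ ^ 2)
      (-(2 * x i)) 0 := by
    have h1 : HasDerivAt (fun t : ℝ => x + t • (EuclideanSpace.single i (1 : ℝ) : E3))
        ((1 : ℝ) • EuclideanSpace.single i (1 : ℝ)) 0 :=
      ((hasDerivAt_id (0 : ℝ)).smul_const _).const_add x
    refine (h1.norm_sq.const_sub 1).congr_deriv ?_
    simp [EuclideanSpace.inner_single_right]
  have hm := hasDerivAt_max_zero_sq (1 - ‖x + (0 : ℝ) • EuclideanSpace.single i (1 : ℝ)‖ ^ 2)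
  refine (hm.comp (0 : ℝ) hn).congr_deriv ?_
  rw [zero_smul, add_zero]
  ring

lemma hasCompactSupport_cutoff_mul {u : E3 → ℝ} : HasCompactSupport fun x => cutoff x * u x :=
  HasCompactSupport.intro (isCompact_closedBall 0 1) fun x hx => by rw [cutoff_eq_zero hx, zero_mul]

lemma integrable_cutoff_mul {u : E3 → ℝ} (hu : Continuous u) :
    Integrable fun x => cutoff x * u x :=
  (continuous_cutoff.mul hu).integrable_of_hasCompactSupport hasCompactSupport_cutoff_mul

lemma integrable_cutoff_mul_mul {u : E3 → ℝ} (hu : Continuous u) :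
    Integrable fun x => cutoff x * (cutoff x * u x) :=
  integrable_cutoff_mul (continuous_cutoff.mul hu)

/-- Integration in polar coordinates of the product of a radial and a homogeneous function. -/
lemma integral_radial_mul_homogeneous {n : ℕ} {P : E3 → ℝ}
    (hP : ∀ c : ℝ, 0 < c → ∀ x, P (c • x) = c ^ n * P x) (w : ℝ → ℝ) :
    ∫ x, w ‖x‖ * P x = (∫ s : S2, P s ∂surf) *
      ∫ r : Ioi (0 : ℝ), w r * (r : ℝ) ^ n ∂(Measure.volumeIoiPow (Module.finrank ℝ E3 - 1)) := by
  calc ∫ x, w ‖x‖ * P x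
      = ∫ x : ({(0)}ᶜ : Set E3), w ‖x.1‖ * P x.1 ∂((volume : Measure E3).comap Subtype.val) := by
        rw [integral_subtype_comap (measurableSet_singleton _).compl fun x ↦ w ‖x‖ * P x,
          restrict_compl_singleton]
    _ = ∫ p : S2 × Ioi (0 : ℝ), P p.1 * (w p.2 * (p.2 : ℝ) ^ n)
          ∂(surf.prod (Measure.volumeIoiPow (Module.finrank ℝ E3 - 1))) := by
        rw [← (volume : Measure E3).measurePreserving_homeomorphUnitSphereProd.integral_comp
          (Homeomorph.measurableEmbedding _)
          (fun p : S2 × Ioi (0 : ℝ) => P p.1 * (w p.2 * (p.2 : ℝ) ^ n))]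
        refine integral_congr_ae (Filter.Eventually.of_forall fun x => ?_)
        have hx : 0 < ‖(x : E3)‖ := norm_pos_iff.2 x.2
        have h := hP ‖(x : E3)‖ hx (‖(x : E3)‖⁻¹ • (x : E3))
        rw [smul_inv_smul₀ hx.ne'] at h
        simp only [homeomorphUnitSphereProd_apply_snd_coe, homeomorphUnitSphereProd_apply_fst_coe]
        rw [h]; ring
    _ = _ := integral_prod_mul (fun s : S2 => P s) (fun r : Ioi (0 : ℝ) => w r * (r : ℝ) ^ n)

/-- In polar coordinates the same radial factor occurs for `P` and for `‖x‖ ^ n`. The latter has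
positive integral against the cutoff, so the factor is nonzero and can be cancelled. -/
lemma integral_sphere_eq_zero {n : ℕ} {P : E3 → ℝ}
    (hP : ∀ c : ℝ, 0 < c → ∀ x, P (c • x) = c ^ n * P x) (h : ∫ x, cutoff x * P x = 0) :
    ∫ s : S2, P s ∂surf = 0 := by
  have h1 := integral_radial_mul_homogeneous hP fun r => max 0 (1 - r ^ 2)
  have h2 := integral_radial_mul_homogeneous (P := fun x => ‖x‖ ^ n) (n := n)
    (fun c hc x => by rw [norm_smul, Real.norm_of_nonneg hc.le, mul_pow])
    fun r => max 0 (1 - r ^ 2)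
  have hpos : 0 < ∫ x : E3, cutoff x * ‖x‖ ^ n := by
    obtain ⟨y, hy⟩ := exists_norm_eq E3 (by norm_num : (0 : ℝ) ≤ 1 / 2)
    refine Continuous.integral_pos_of_hasCompactSupport_nonneg_nonzero (x := y)
      (continuous_cutoff.mul (by fun_prop)) hasCompactSupport_cutoff_mul
      (fun x => mul_nonneg (le_max_left _ _) (by positivity)) ?_
    rw [cutoff, hy]
    norm_num
  change ∫ x, cutoff x * P x = _ at h1
  change ∫ x : E3, cutoff x * ‖x‖ ^ n = _ at h2
  rw [h] at h1
  rw [h2] at hpos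
  exact (mul_eq_zero.1 h1.symm).resolve_right (right_ne_zero_of_mul hpos.ne')

lemma evalAt_smul {l : ℕ} {p : MvPolynomial (Fin 3) ℝ} (hp : p.IsHomogeneous l) (c : ℝ) (x : E3) :
    evalAt p (c • x) = c ^ l * evalAt p x :=
  eval_smul_of_isHomogeneous hp c fun i => x i

/-- Integration by parts with `∇ (1 - |x|²)₊² = -4 (1 - |x|²)₊ x`; summed over `i` it replaces a
divergence by a radial component. -/
lemma integral_cutoff_sq_mul_pderiv (p : MvPolynomial (Fin 3) ℝ) (i : Fin 3) :
    ∫ x, cutoff x * (cutoff x * evalAt (pderiv i p) x) =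
      4 * ∫ x, cutoff x * evalAt (X i * p) x := by
  have h := integral_bilinear_hasLineDerivAt_right_eq_neg_left_of_integrable (μ := volume)
    (f := fun x => cutoff x ^ 2) (f' := fun x => -4 * (x i * cutoff x))
    (g := evalAt p) (g' := evalAt (pderiv i p))
    (v := EuclideanSpace.single i 1) (B := ContinuousLinearMap.mul ℝ ℝ)
    ?_ ?_ ?_ (fun x _ => hasLineDerivAt_cutoff_sq x i) (fun x _ => hasLineDerivAt_evalAt p x i)
  · simp only [ContinuousLinearMap.mul_apply'] at h
    rw [← integral_const_mul, ← neg_neg (∫ x, 4 * _), ← integral_neg]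
    calc _ = ∫ x, cutoff x ^ 2 * evalAt (pderiv i p) x := by
          refine integral_congr_ae (Filter.Eventually.of_forall fun x => ?_)
          simp only; ring
      _ = _ := by
          rw [h]
          congr 1
          refine integral_congr_ae (Filter.Eventually.of_forall fun x => ?_)
          simp only [evalAt, map_mul, eval_X]; ring
  · refine (integrable_cutoff_mul (u := fun x => -4 * (x i * evalAt p x)) ?_).congr
      (Filter.Eventually.of_forall fun x => ?_)
    · have := continuous_evalAt p
      fun_prop
    · simp only [ContinuousLinearMap.mul_apply']; ring
  · refine (integrable_cutoff_mul_mul (continuous_evalAt (pderiv i p))).congr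
      (Filter.Eventually.of_forall fun x => ?_)
    simp only [ContinuousLinearMap.mul_apply']; ring
  · refine (integrable_cutoff_mul_mul (continuous_evalAt p)).congr
      (Filter.Eventually.of_forall fun x => ?_)
    simp only [ContinuousLinearMap.mul_apply']; ring

/-- Harmonic homogeneous polynomials of different degrees are orthogonal on the sphere. -/
theorem integral_evalAt_mul_eq_zero {l m : ℕ} (hlm : l ≠ m) {p q : MvPolynomial (Fin 3) ℝ}
    (hp : p.IsHomogeneous l) (hq : q.IsHomogeneous m)
    (hpL : polyLaplacian p = 0) (hqL : polyLaplacian q = 0) :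
    ∫ s : S2, evalAt p s * evalAt q s ∂surf = 0 := by
  -- The vector field of Green's identity: divergence-free because `p` and `q` are harmonic, with `x
  -- · G = (m - l) p q` by Euler's identity.
  let G : Fin 3 → MvPolynomial (Fin 3) ℝ := fun i => p * pderiv i q - q * pderiv i p
  have hdiv : ∑ i, pderiv i (G i) = 0 := by
    rw [polyLaplacian_apply, Fin.sum_univ_three] at hpL hqL
    simp only [G, Fin.sum_univ_three, map_sub, Derivation.leibniz, smul_eq_mul]
    linear_combination p * hqL - q * hpL
  have heul : ∑ i, X i * G i = C ((m : ℝ) - l) * (p * q) := by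
    have h1 := hp.sum_X_mul_pderiv
    have h2 := hq.sum_X_mul_pderiv
    rw [Fin.sum_univ_three, nsmul_eq_mul] at h1 h2
    simp only [G, Fin.sum_univ_three, map_sub, map_natCast]
    linear_combination p * h2 - q * h1
  have hsum : ∫ x : E3, cutoff x * (cutoff x * evalAt (∑ i, pderiv i (G i)) x) =
      4 * ∫ x : E3, cutoff x * evalAt (∑ i, X i * G i) x := by
    have e1 : ∀ x, cutoff x * (cutoff x * evalAt (∑ i, pderiv i (G i)) x) =
        ∑ i, cutoff x * (cutoff x * evalAt (pderiv i (G i)) x) := fun x => by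
      simp only [evalAt, map_sum, Finset.mul_sum]
    have e2 : ∀ x, cutoff x * evalAt (∑ i, X i * G i) x =
        ∑ i, cutoff x * evalAt (X i * G i) x := fun x => by
      simp only [evalAt, map_sum, Finset.mul_sum]
    simp only [e1, e2]
    rw [integral_finsetSum _ fun i _ => integrable_cutoff_mul_mul
        (continuous_evalAt _),
      integral_finsetSum _ fun i _ => integrable_cutoff_mul (continuous_evalAt _), Finset.mul_sum]
    exact Finset.sum_congr rfl fun i _ => integral_cutoff_sq_mul_pderiv (G i) i
  rw [hdiv, heul] at hsum
  have hz : ∫ x : E3, cutoff x * (evalAt p x * evalAt q x) = 0 := by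
    have e3 : ∀ x : E3, cutoff x * evalAt (C ((m : ℝ) - l) * (p * q)) x =
        ((m : ℝ) - l) * (cutoff x * (evalAt p x * evalAt q x)) := fun x => by
      simp only [evalAt, map_mul, eval_C]; ring
    simp only [e3, integral_const_mul] at hsum
    have hne : ((m : ℝ) - l) ≠ 0 := sub_ne_zero.2 (by exact_mod_cast hlm.symm)
    simpa [evalAt, hne] using hsum
  refine integral_sphere_eq_zero (n := l + m) (P := fun x => evalAt p x * evalAt q x)
    (fun c _ x => ?_) hz
  rw [evalAt_smul hp, evalAt_smul hq, pow_add]; ring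

end Orthogonality

/-! ### Reproducing kernels and the addition theorem -/

section Reproducing

open MvPolynomial Filter Topology

/-- The cosine of the angle between two directions. -/
def cosAngle (s s' : S2) : ℝ :=
  inner ℝ (s : EuclideanSpace ℝ (Fin 3)) (s' : EuclideanSpace ℝ (Fin 3))

lemma continuous_cosAngle : Continuous fun p : S2 × S2 => cosAngle p.1 p.2 := by
  unfold cosAngle; fun_prop

lemma abs_cosAngle_le_one (s s' : S2) : |cosAngle s s'| ≤ 1 := by
  have h := abs_real_inner_le_norm (s : EuclideanSpace ℝ (Fin 3)) (s' : EuclideanSpace ℝ (Fin 3))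
  simpa [cosAngle, norm_eq_of_mem_sphere] using h

lemma cosAngle_eq_sum (s s' : S2) :
    cosAngle s s' = ∑ i, (s : EuclideanSpace ℝ (Fin 3)) i * (s' : EuclideanSpace ℝ (Fin 3)) i := by
  rw [cosAngle, PiLp.inner_apply]
  exact Finset.sum_congr rfl fun i _ => by simp [mul_comm]

lemma cosAngle_self (s : S2) : cosAngle s s = 1 := by
  rw [cosAngle, real_inner_self_eq_norm_sq, norm_eq_of_mem_sphere, one_pow]

lemma sum_sq_coord (s : S2) : ∑ i, (s : EuclideanSpace ℝ (Fin 3)) i ^ 2 = 1 := by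
  refine Eq.trans ?_ (cosAngle_self s)
  rw [cosAngle_eq_sum]
  exact Finset.sum_congr rfl fun i _ => sq _

lemma continuous_legendre (n : ℕ) : Continuous fun t => legendre t n := by
  induction n using Nat.twoStepInduction with
  | zero => exact continuous_const
  | one => exact continuous_id
  | more n ih0 ih1 => simp only [legendre]; fun_prop

/-- The reproducing kernel of the spherical harmonics of degree `l`. -/
def zonalKernel (l : ℕ) (s s' : S2) : ℝ :=
  (2 * l + 1) / (4 * Real.pi) * legendre (cosAngle s s') l

lemma continuous_zonalKernel (l : ℕ) : Continuous fun p : S2 × S2 => zonalKernel l p.1 p.2 :=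
  continuous_const.mul ((continuous_legendre l).comp continuous_cosAngle)

lemma continuous_zonalKernel_right (l : ℕ) (s : S2) : Continuous (zonalKernel l s) :=
  (continuous_zonalKernel l).comp (Continuous.prodMk_right s)

lemma abs_zonalKernel_le (l : ℕ) (s s' : S2) :
    |zonalKernel l s s'| ≤ (2 * l + 1) / (4 * Real.pi) := by
  rw [zonalKernel, abs_mul, abs_of_nonneg (by positivity)]
  exact mul_le_of_le_one_right (by positivity) (abs_legendre_le_one (abs_cosAngle_le_one s s') l)

lemma zonalKernel_self (l : ℕ) (s : S2) : zonalKernel l s s = (2 * l + 1) / (4 * Real.pi) := by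
  rw [zonalKernel, cosAngle_self, legendre_one, mul_one]

lemma isSphericalHarmonic_zonalKernel (l : ℕ) (s : S2) :
    IsSphericalHarmonic l ⟨zonalKernel l s, continuous_zonalKernel_right l s⟩ := by
  refine ⟨C ((2 * l + 1) / (4 * Real.pi) : ℝ) *
    zonal (fun i => (s : EuclideanSpace ℝ (Fin 3)) i) l, (zonal_isHomogeneous _ l).C_mul _, ?_, ?_⟩
  · rw [polyLaplacian_C_mul, polyLaplacian_zonal (sum_sq_coord s), mul_zero]
  · intro s'
    rw [map_mul, eval_C, eval_zonal _ (sum_sq_coord s'), ← cosAngle_eq_sum]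
    rfl

lemma integral_mul_sphericalHarmonic {l m : ℕ} (hlm : l ≠ m) {f h : C(S2, ℝ)}
    (hf : IsSphericalHarmonic l f) (hh : IsSphericalHarmonic m h) :
    ∫ s, f s * h s ∂surf = 0 := by
  obtain ⟨p, hp, hpL, hpf⟩ := hf
  obtain ⟨q, hq, hqL, hqh⟩ := hh
  simp only [hpf, hqh]
  exact integral_evalAt_mul_eq_zero hlm hp hq hpL hqL

lemma surf_real_univ : surf.real Set.univ = 4 * Real.pi := by
  rw [Measure.toSphere_real_apply_univ, measureReal_def, EuclideanSpace.volume_ball_fin_three]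
  simp [ENNReal.toReal_ofReal (by positivity : (0 : ℝ) ≤ Real.pi * 4 / 3)]
  ring

/-- The expansion at `t = 1`, where every Legendre value is `1`, is the majorant for all angles. -/
lemma summable_zonalKernel_bound {a : ℝ} (ha0 : 0 ≤ a) (ha : a < 1) :
    Summable fun n : ℕ => a ^ n * ((2 * n + 1) / (4 * Real.pi)) := by
  have h := (hasSum_hgPhase (t := 1) (by simp) (by rwa [abs_of_nonneg ha0] : |a| < 1)).summable
  simpa [legendre_one] using h

lemma hasSum_hgPhase_zonalKernel {a : ℝ} (ha0 : 0 ≤ a) (ha : a < 1) (s s' : S2) :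
    HasSum (fun n : ℕ => a ^ n * zonalKernel n s s') (hgPhase a (cosAngle s s')) :=
  hasSum_hgPhase (abs_cosAngle_le_one s s') (by rwa [abs_of_nonneg ha0])

/-- Termwise integration of a uniformly summable series against an integrable function. -/
lemma hasSum_integral_mul_of_bound {α : Type*} [MeasurableSpace α] {μ : Measure α}
    {F : ℕ → α → ℝ} {G f : α → ℝ} {b : ℕ → ℝ} (hb : Summable b)
    (hF : ∀ n, AEStronglyMeasurable (F n) μ) (hFb : ∀ n s, |F n s| ≤ b n)
    (hG : ∀ s, HasSum (fun n => F n s) (G s)) (hf : Integrable f μ) :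
    HasSum (fun n => ∫ s, F n s * f s ∂μ) (∫ s, G s * f s ∂μ) := by
  refine hasSum_integral_of_dominated_convergence (fun n s => b n * |f s|)
    (fun n => (hF n).mul hf.aestronglyMeasurable)
    (fun n => Eventually.of_forall fun s => ?_) (Eventually.of_forall fun s => hb.mul_right _) ?_
    (Eventually.of_forall fun s => (hG s).mul_right _)
  · rw [norm_mul, Real.norm_eq_abs, Real.norm_eq_abs]
    exact mul_le_mul_of_nonneg_right (hFb n s) (abs_nonneg _)
  · simp only [tsum_mul_right]
    exact hf.abs.const_mul _

lemma hasSum_integral_hgPhase_mul {a : ℝ} (ha0 : 0 ≤ a) (ha : a < 1) (s : S2) {f : S2 → ℝ}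
    (hf : Integrable f surf) :
    HasSum (fun n : ℕ => a ^ n * ∫ s', zonalKernel n s s' * f s' ∂surf)
      (∫ s', hgPhase a (cosAngle s s') * f s' ∂surf) := by
  have h := hasSum_integral_mul_of_bound (F := fun n s' => a ^ n * zonalKernel n s s')
    (summable_zonalKernel_bound ha0 ha)
    (fun n => (continuous_const.mul (continuous_zonalKernel_right n s)).aestronglyMeasurable)
    (fun n s' => by
      rw [abs_mul, abs_of_nonneg (by positivity : 0 ≤ a ^ n)]
      exact mul_le_mul_of_nonneg_left (abs_zonalKernel_le n s s') (by positivity))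
    (fun s' => hasSum_hgPhase_zonalKernel ha0 ha s s') hf
  simpa only [mul_assoc, integral_const_mul] using h

lemma integrable_continuousMap (h : C(S2, ℝ)) : Integrable h surf :=
  h.continuous.integrable_of_hasCompactSupport (HasCompactSupport.of_compactSpace _)

/-- The zonal kernel of degree `n` is itself a harmonic of degree `n`, so orthogonality removes
every term with `n ≠ l`. -/
lemma integral_hgPhase_mul_sphericalHarmonic {a : ℝ} (ha0 : 0 ≤ a) (ha : a < 1) (s : S2) {l : ℕ}
    {h : C(S2, ℝ)} (hh : IsSphericalHarmonic l h) :
    ∫ s', hgPhase a (cosAngle s s') * h s' ∂surf =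
      a ^ l * ∫ s', zonalKernel l s s' * h s' ∂surf := by
  refine (hasSum_integral_hgPhase_mul ha0 ha s (integrable_continuousMap h)).unique
    (hasSum_single l fun n hn => ?_)
  rw [mul_eq_zero]
  exact Or.inr (integral_mul_sphericalHarmonic hn (isSphericalHarmonic_zonalKernel n s) hh)

/-- Constants are the harmonics of degree `0`, where the zonal kernel is `1 / (4π)`. This is the
normalization of the approximate identity. -/
lemma integral_hgPhase {a : ℝ} (ha0 : 0 ≤ a) (ha : a < 1) (s : S2) :
    ∫ s', hgPhase a (cosAngle s s') ∂surf = 1 := by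
  have h1 : IsSphericalHarmonic 0 (1 : C(S2, ℝ)) :=
    ⟨1, isHomogeneous_one _ _, by simp [polyLaplacian_apply], fun s => by simp⟩
  have h := integral_hgPhase_mul_sphericalHarmonic ha0 ha s h1
  simp only [ContinuousMap.one_apply, mul_one, pow_zero, one_mul, zonalKernel, legendre,
    integral_const, surf_real_univ] at h
  rw [h, smul_eq_mul]
  have := Real.pi_ne_zero
  field_simp
  simp

lemma continuous_hgPhase_cosAngle {a : ℝ} (ha0 : 0 ≤ a) (ha : a < 1) :
    Continuous fun p : S2 × S2 => hgPhase a (cosAngle p.1 p.2) :=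
  (hgKernel a ha0 ha).continuous

lemma hgPhase_nonneg {a t : ℝ} (ha0 : 0 ≤ a) (ha : a < 1) (ht : t ≤ 1) : 0 ≤ hgPhase a t := by
  have := hg_denom_pos ha0 ha ht
  have h2 : 0 ≤ 1 - a ^ 2 := by nlinarith
  unfold hgPhase
  positivity

/-- The denominator is the `3/2` power of `(1 - a)² + 2a (1 - t)`, and `2a ≥ 1`. The bound tends to
`0` as `a → 1`, uniformly away from the pole. -/
lemma hgPhase_le_of_le {a t ε : ℝ} (ha0 : 1 / 2 ≤ a) (ha : a < 1) (hε : 0 < ε)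
    (ht : t ≤ 1 - ε) :
    hgPhase a t ≤ 1 / (4 * Real.pi) * ((1 - a ^ 2) / ε ^ (3 / 2 : ℝ)) := by
  have h2 : 0 ≤ 1 - a ^ 2 := by nlinarith
  have h3 : ε ≤ 1 - 2 * a * t + a ^ 2 := by nlinarith [sq_nonneg (1 - a)]
  unfold hgPhase
  gcongr

/-- The Henyey–Greenstein kernel is an approximate identity as the anisotropy factor tends
to `1`. -/
lemma tendsto_integral_hgPhase_mul (s : S2) (h : C(S2, ℝ)) :
    Tendsto (fun a => ∫ s', hgPhase a (cosAngle s s') * h s' ∂surf) (𝓝[<] 1) (𝓝 (h s)) := by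
  have hev : ∀ᶠ a in 𝓝[<] (1 : ℝ), 1 / 2 ≤ a ∧ a < 1 := by
    filter_upwards [self_mem_nhdsWithin,
      mem_nhdsWithin_of_mem_nhds (lt_mem_nhds (by norm_num : (1 / 2 : ℝ) < 1))] with a h1 h2
    exact ⟨le_of_lt h2, h1⟩
  refine tendsto_integral_peak_smul_of_integrable_of_tendsto (t := Set.univ) (x₀ := s)
    (φ := fun a s' => hgPhase a (cosAngle s s')) MeasurableSet.univ univ_mem
    (measure_ne_top _ _) ?_ ?_ ?_ ?_ (integrable_continuousMap h) h.continuous.continuousAt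
  · filter_upwards [hev] with a ha s'
    exact hgPhase_nonneg (by linarith) ha.2 (inner_le_one _ _)
  · intro u hu hsu
    obtain ⟨ε, hε, hball⟩ := Metric.isOpen_iff.1 hu s hsu
    -- Since `|s - s'|² = 2 - 2 s · s'`, distance at least `ε` means cosine at most `1 - ε² / 2`.
    have hδ : 0 < ε ^ 2 / 2 := by positivity
    have hlim : Tendsto (fun a : ℝ => 1 / (4 * Real.pi) * ((1 - a ^ 2) / (ε ^ 2 / 2) ^ (3 / 2 : ℝ)))
        (𝓝[<] 1) (𝓝 0) := by
      refine tendsto_nhdsWithin_of_tendsto_nhds ?_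
      have : Continuous fun a : ℝ =>
        1 / (4 * Real.pi) * ((1 - a ^ 2) / (ε ^ 2 / 2) ^ (3 / 2 : ℝ)) := by fun_prop
      simpa using this.tendsto 1
    rw [Metric.tendstoUniformlyOn_iff]
    intro η hη
    filter_upwards [hev, hlim.eventually (gt_mem_nhds hη)] with a ha hsmall s' hs'
    have hd : ε ≤ dist s' s := by
      by_contra hlt
      exact hs' (hball (by simpa using hlt))
    have hcos : cosAngle s s' ≤ 1 - ε ^ 2 / 2 := by
      have hn := norm_sub_sq_real (s : EuclideanSpace ℝ (Fin 3)) (s' : EuclideanSpace ℝ (Fin 3))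
      rw [norm_eq_of_mem_sphere, norm_eq_of_mem_sphere] at hn
      rw [dist_comm, Subtype.dist_eq, dist_eq_norm] at hd
      have : ε ^ 2 ≤ ‖(s : EuclideanSpace ℝ (Fin 3)) - s'‖ ^ 2 := by gcongr
      unfold cosAngle
      linarith
    have hnn : 0 ≤ hgPhase a (cosAngle s s') :=
      hgPhase_nonneg (by linarith) ha.2 (inner_le_one _ _)
    simp only [Pi.zero_apply, dist_zero_left, Real.norm_of_nonneg hnn]
    exact (hgPhase_le_of_le ha.1 ha.2 hδ hcos).trans_lt hsmall
  · refine tendsto_const_nhds.congr' ?_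
    filter_upwards [hev] with a ha
    rw [setIntegral_univ, integral_hgPhase (by linarith) ha.2]
  · filter_upwards [hev] with a ha
    exact ((continuous_hgPhase_cosAngle (by linarith) ha.2).comp
      (Continuous.prodMk_right s)).aestronglyMeasurable

/-- The reproducing property of the zonal kernel. -/
theorem integral_zonalKernel_mul {l : ℕ} {h : C(S2, ℝ)} (hh : IsSphericalHarmonic l h) (s : S2) :
    ∫ s', zonalKernel l s s' * h s' ∂surf = h s := by
  -- Both sides are limits as `a → 1⁻` of the Henyey–Greenstein integral of `h`: one by
  -- orthogonality of degrees, the other by the approximate identity.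
  refine tendsto_nhds_unique (f := fun a : ℝ => a ^ l * ∫ s', zonalKernel l s s' * h s' ∂surf)
    (l := 𝓝[<] 1) ?_ ?_
  · refine tendsto_nhdsWithin_of_tendsto_nhds ?_
    have : Continuous fun a : ℝ => a ^ l * ∫ s', zonalKernel l s s' * h s' ∂surf := by fun_prop
    simpa using this.tendsto 1
  · refine (tendsto_integral_hgPhase_mul s h).congr' ?_
    filter_upwards [self_mem_nhdsWithin,
      mem_nhdsWithin_of_mem_nhds (lt_mem_nhds (by norm_num : (0 : ℝ) < 1))] with a h1 h2
    exact integral_hgPhase_mul_sphericalHarmonic h2.le h1 s hh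

lemma eq_zero_of_integral_eq_zero {f : S2 → ℝ} (hf : Continuous f) (h0 : ∀ s, 0 ≤ f s)
    (hi : ∫ s, f s ∂surf = 0) (s : S2) : f s = 0 := by
  have hint := integrable_continuousMap ⟨f, hf⟩
  have h := (integral_eq_zero_iff_of_nonneg h0 hint).1 hi
  exact congrFun ((Continuous.ae_eq_iff_eq surf hf continuous_const).1 h) s

/-- The addition theorem for spherical harmonics. -/
theorem sum_harmonic_mul_harmonic {H : ℕ → ℤ → C(S2, ℝ)} (hH : IsSphericalHarmonics H) (l : ℕ)
    (s s' : S2) :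
    ∑ m ∈ Finset.Icc (-l : ℤ) l, H l m s * H l m s' = zonalKernel l s s' := by
  set I := Finset.Icc (-l : ℤ) l with hI
  have hcard : (I.card : ℝ) = 2 * l + 1 := by
    rw [hI, Int.card_Icc]
    have : (((l : ℤ) + 1 - -(l : ℤ)).toNat) = 2 * l + 1 := by omega
    rw [this]; push_cast; ring
  have hci : ∀ {f : S2 → ℝ}, Continuous f → Integrable f surf := fun hf =>
    integrable_continuousMap ⟨_, hf⟩
  have hZc := continuous_zonalKernel_right l
  -- On expanding the square, the reproducing property gives `Z(s, s)` and the cross term `-2 ∑ H²`,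
  -- and orthonormality returns `+ ∑ H²`.
  have hdefect : ∀ s, ∫ s', (zonalKernel l s s' - ∑ m ∈ I, H l m s * H l m s') ^ 2 ∂surf =
      (2 * l + 1) / (4 * Real.pi) - ∑ m ∈ I, H l m s ^ 2 := by
    intro s
    have hZ := integral_zonalKernel_mul (isSphericalHarmonic_zonalKernel l s) s
    simp only [ContinuousMap.coe_mk, zonalKernel_self] at hZ
    have hcZ := hZc s
    have e : ∀ s', (zonalKernel l s s' - ∑ m ∈ I, H l m s * H l m s') ^ 2 =
        zonalKernel l s s' * zonalKernel l s s' -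
          ∑ m ∈ I, 2 * H l m s * (zonalKernel l s s' * H l m s') +
          ∑ m ∈ I, ∑ m' ∈ I, H l m s * H l m' s * (H l m s' * H l m' s') := by
      intro s'
      have : ∑ m ∈ I, ∑ m' ∈ I, H l m s * H l m' s * (H l m s' * H l m' s') =
          (∑ m ∈ I, H l m s * H l m s') * ∑ m ∈ I, H l m s * H l m s' := by
        rw [Finset.sum_mul_sum]
        exact Finset.sum_congr rfl fun m _ => Finset.sum_congr rfl fun m' _ => by ring
      have h2 : ∑ m ∈ I, 2 * H l m s * (zonalKernel l s s' * H l m s') =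
          2 * zonalKernel l s s' * ∑ m ∈ I, H l m s * H l m s' := by
        rw [Finset.mul_sum]
        exact Finset.sum_congr rfl fun m _ => by ring
      rw [this, h2]; ring
    simp only [e]
    rw [integral_add (hci (by fun_prop)) (hci (by fun_prop)),
      integral_sub (hci (by fun_prop)) (hci (by fun_prop)), hZ,
      integral_finsetSum _ fun m _ => hci (by fun_prop),
      integral_finsetSum _ fun m _ => hci (by fun_prop)]
    have e1 : ∀ m ∈ I, ∫ s', 2 * H l m s * (zonalKernel l s s' * H l m s') ∂surf =
        2 * H l m s ^ 2 := fun m hm => by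
      rw [integral_const_mul, integral_zonalKernel_mul (hH.harmonic l m hm)]; ring
    have e2 : ∀ m ∈ I, ∫ s', ∑ m' ∈ I, H l m s * H l m' s * (H l m s' * H l m' s') ∂surf =
        H l m s ^ 2 := fun m hm => by
      rw [integral_finsetSum _ fun m' _ => hci (by fun_prop),
        Finset.sum_congr rfl fun m' hm' => by
          rw [integral_const_mul, hH.orthonormal l m hm m' hm']]
      simp only [mul_ite, mul_one, mul_zero, Finset.sum_ite_eq, hm, if_true]
      ring
    rw [Finset.sum_congr rfl e1, Finset.sum_congr rfl e2, ← Finset.mul_sum]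
    ring
  -- The defect is nonnegative, and its integral over `s` is `4π (2l + 1) / (4π) - (2l + 1) = 0`.
  -- The count of the `H l m` thus forces equality, without knowing beforehand that they span.
  have hzero : ∀ s, (2 * l + 1) / (4 * Real.pi) - ∑ m ∈ I, H l m s ^ 2 = 0 := by
    refine eq_zero_of_integral_eq_zero (by fun_prop) (fun s => ?_) ?_
    · rw [← hdefect s]
      exact integral_nonneg fun s' => sq_nonneg _
    · rw [integral_sub (hci (by fun_prop)) (hci (by fun_prop)), integral_const, surf_real_univ,
        integral_finsetSum _ fun m _ => hci (by fun_prop),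
        Finset.sum_congr rfl (g := fun _ => (1 : ℝ)) fun m hm => by
          simp only [sq]; rw [hH.orthonormal l m hm m hm, if_pos rfl],
        Finset.sum_const, nsmul_eq_mul, hcard, smul_eq_mul]
      have := Real.pi_ne_zero
      field_simp
      ring
  have hsq := eq_zero_of_integral_eq_zero (f := fun s' =>
    (zonalKernel l s s' - ∑ m ∈ I, H l m s * H l m s') ^ 2)
    (by have := hZc s; fun_prop) (fun _ => sq_nonneg _) (by rw [hdefect, hzero]) s'
  exact (sub_eq_zero.1 (pow_eq_zero_iff two_ne_zero |>.1 hsq)).symm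

/-- The energy of `f` in degree `l`, the squared norm of its projection on the spherical harmonics
of degree `l`. -/
def degreeEnergy (H : ℕ → ℤ → C(S2, ℝ)) (f : S2 → ℝ) (l : ℕ) : ℝ :=
  ∑ m ∈ Finset.Icc (-l : ℤ) l, (∫ s, f s * H l m s ∂surf) ^ 2

lemma degreeEnergy_nonneg (H : ℕ → ℤ → C(S2, ℝ)) (f : S2 → ℝ) (l : ℕ) :
    0 ≤ degreeEnergy H f l :=
  Finset.sum_nonneg fun _ _ => sq_nonneg _

lemma integrable_mul_continuousMap {f : S2 → ℝ} (hf : Integrable f surf) (h : C(S2, ℝ)) :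
    Integrable (fun s => f s * h s) surf :=
  hf.mul_bdd (c := ‖h‖) h.continuous.aestronglyMeasurable
    (Eventually.of_forall fun s => h.norm_coe_le_norm s)

lemma integral_zonalKernel_mul_eq_sum {H : ℕ → ℤ → C(S2, ℝ)} (hH : IsSphericalHarmonics H)
    {f : S2 → ℝ} (hf : Integrable f surf) (l : ℕ) (s : S2) :
    ∫ s', zonalKernel l s s' * f s' ∂surf =
      ∑ m ∈ Finset.Icc (-l : ℤ) l, (∫ s', f s' * H l m s' ∂surf) * H l m s := by
  simp only [← sum_harmonic_mul_harmonic hH, Finset.sum_mul]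
  have e : ∀ m s', H l m s * H l m s' * f s' = f s' * H l m s' * H l m s := fun m s' => by ring
  simp only [e]
  rw [integral_finsetSum _ fun m _ => (integrable_mul_continuousMap hf _).mul_const _]
  exact Finset.sum_congr rfl fun m _ => integral_mul_const _ _

lemma integral_sum_harmonic_mul (H : ℕ → ℤ → C(S2, ℝ))
    {f : S2 → ℝ} (hf : Integrable f surf) (l : ℕ) :
    ∫ s, (∑ m ∈ Finset.Icc (-l : ℤ) l, (∫ s', f s' * H l m s' ∂surf) * H l m s) * f s ∂surf =
      degreeEnergy H f l := by
  simp only [Finset.sum_mul, degreeEnergy]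
  have e : ∀ m s, (∫ s', f s' * H l m s' ∂surf) * H l m s * f s =
    (∫ s', f s' * H l m s' ∂surf) * (f s * H l m s) := fun m s => by ring
  simp only [e]
  rw [integral_finsetSum _ fun m _ => (integrable_mul_continuousMap hf _).const_mul _]
  exact Finset.sum_congr rfl fun m _ => by rw [integral_const_mul, sq]

/-- The quadratic form of the Henyey–Greenstein kernel in terms of spherical harmonics. -/
theorem hasSum_degreeEnergy {H : ℕ → ℤ → C(S2, ℝ)} (hH : IsSphericalHarmonics H) {a : ℝ}
    (ha0 : 0 ≤ a) (ha : a < 1) {f : S2 → ℝ} (hf : Integrable f surf) :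
    HasSum (fun l : ℕ => a ^ l * degreeEnergy H f l)
      (∫ s, (∫ s', hgPhase a (cosAngle s s') * f s' ∂surf) * f s ∂surf) := by
  have h := hasSum_integral_mul_of_bound
    (F := fun n s => a ^ n * ∫ s', zonalKernel n s s' * f s' ∂surf)
    (G := fun s => ∫ s', hgPhase a (cosAngle s s') * f s' ∂surf)
    ((summable_zonalKernel_bound ha0 ha).mul_right (∫ s', |f s'| ∂surf))
    (fun n => ?_) (fun n s => ?_) (fun s => hasSum_integral_hgPhase_mul ha0 ha s hf) hf
  · simp only [integral_zonalKernel_mul_eq_sum hH hf, mul_assoc, integral_const_mul,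
      integral_sum_harmonic_mul H hf] at h
    exact h
  · simp only [integral_zonalKernel_mul_eq_sum hH hf]
    refine Continuous.aestronglyMeasurable ?_
    fun_prop
  · rw [abs_mul, abs_of_nonneg (by positivity : 0 ≤ a ^ n), mul_assoc]
    refine mul_le_mul_of_nonneg_left ?_ (by positivity)
    rw [← integral_const_mul]
    refine (abs_integral_le_integral_abs).trans (integral_mono_of_nonneg
      (Eventually.of_forall fun _ => abs_nonneg _) (hf.abs.const_mul _)
      (Eventually.of_forall fun s' => ?_))
    simp only [abs_mul]
    exact mul_le_mul_of_nonneg_right (abs_zonalKernel_le n s s') (abs_nonneg _)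

end Reproducing

/-! ### Bessel's inequality on the sphere -/

section Bessel

open Filter Topology

lemma orthonormal_harmonics {H : ℕ → ℤ → C(S2, ℝ)} (hH : IsSphericalHarmonics H) :
    Orthonormal ℝ fun i : (Σ l : ℕ, Finset.Icc (-l : ℤ) l) =>
      ContinuousMap.toLp (E := ℝ) 2 surf ℝ (H i.1 i.2) := by
  classical
  rw [orthonormal_iff_ite]
  rintro ⟨l, m, hm⟩ ⟨l', m', hm'⟩
  rw [ContinuousMap.inner_toLp]
  simp only [conj_trivial]
  rcases eq_or_ne l l' with rfl | hl
  · rw [hH.orthonormal l m' hm' m hm]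
    refine if_congr ?_ rfl rfl
    simp [eq_comm]
  · rw [integral_mul_sphericalHarmonic hl.symm (hH.harmonic l' m' hm') (hH.harmonic l m hm),
      if_neg (by simp [hl])]

lemma sum_degreeEnergy_le {H : ℕ → ℤ → C(S2, ℝ)} (hH : IsSphericalHarmonics H) {f : S2 → ℝ}
    (hf : MemLp f 2 surf) (M : ℕ) :
    ∑ l ∈ Finset.range M, degreeEnergy H f l ≤ ∫ s, f s * f s ∂surf := by
  have h := (orthonormal_harmonics hH).sum_inner_products_le (hf.toLp f)
    (s := (Finset.range M).sigma fun l => Finset.univ)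
  rw [Finset.sum_sigma] at h
  have hn : ‖hf.toLp f‖ ^ 2 = ∫ s, f s * f s ∂surf := by
    rw [← real_inner_self_eq_norm_sq, L2.inner_def]
    refine integral_congr_ae ?_
    filter_upwards [hf.coeFn_toLp] with s hs
    simp [hs, sq]
  rw [hn] at h
  refine le_trans (le_of_eq (Finset.sum_congr rfl fun l _ => ?_)) h
  rw [degreeEnergy, ← Finset.sum_coe_sort]
  refine Finset.sum_congr rfl fun m _ => ?_
  rw [Real.norm_eq_abs, sq_abs, L2.inner_def]
  congr 1
  refine integral_congr_ae ?_
  filter_upwards [hf.coeFn_toLp, ContinuousMap.coeFn_toLp (p := 2) (𝕜 := ℝ) surf (H l m)]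
    with s hs hs'
  rw [hs, hs']
  simp

variable {H : ℕ → ℤ → C(S2, ℝ)} {a : ℝ} {f : S2 → ℝ}

lemma sum_pow_mul_degreeEnergy_le_hg (hH : IsSphericalHarmonics H) (ha0 : 0 ≤ a) (ha : a < 1)
    (hf : MemLp f 2 surf) (M : ℕ) :
    ∑ l ∈ Finset.range M, a ^ l * degreeEnergy H f l ≤
      ∫ s, (∫ s', hgPhase a (cosAngle s s') * f s' ∂surf) * f s ∂surf :=
  sum_le_hasSum _ (fun l _ => mul_nonneg (by positivity) (degreeEnergy_nonneg H f l))
    (hasSum_degreeEnergy hH ha0 ha (hf.integrable one_le_two))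

lemma sum_pow_mul_degreeEnergy_le (ha0 : 0 ≤ a) (ha : a < 1) (M : ℕ) :
    ∑ l ∈ Finset.range M, a ^ l * degreeEnergy H f l ≤
      ∑ l ∈ Finset.range M, degreeEnergy H f l :=
  Finset.sum_le_sum fun l _ =>
    mul_le_of_le_one_left (degreeEnergy_nonneg H f l) (pow_le_one₀ ha0 ha.le)

/-- In the tail `a^l ≤ a^M`, and Bessel's inequality bounds the tail energy. Working with its
partial sums makes Parseval's identity unnecessary. -/
lemma hg_sub_sum_pow_mul_degreeEnergy_le (hH : IsSphericalHarmonics H) (ha0 : 0 ≤ a) (ha : a < 1)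
    (hf : MemLp f 2 surf) (M : ℕ) :
    (∫ s, (∫ s', hgPhase a (cosAngle s s') * f s' ∂surf) * f s ∂surf) -
        ∑ l ∈ Finset.range M, a ^ l * degreeEnergy H f l ≤
      a ^ M * ((∫ s, f s * f s ∂surf) - ∑ l ∈ Finset.range M, degreeEnergy H f l) := by
  have h := (hasSum_nat_add_iff' M).2 (hasSum_degreeEnergy hH ha0 ha (hf.integrable one_le_two))
  refine le_of_tendsto' h.tendsto_sum_nat fun n => ?_
  have hB := sum_degreeEnergy_le hH hf (M + n)
  rw [Finset.sum_range_add] at hB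
  calc ∑ j ∈ Finset.range n, a ^ (j + M) * degreeEnergy H f (j + M)
      ≤ ∑ j ∈ Finset.range n, a ^ M * degreeEnergy H f (M + j) := by
        refine Finset.sum_le_sum fun j _ => ?_
        rw [add_comm j M]
        exact mul_le_mul_of_nonneg_right (pow_le_pow_of_le_one ha0 ha.le (Nat.le_add_right M j))
          (degreeEnergy_nonneg H f _)
    _ ≤ _ := by
        rw [← Finset.mul_sum]
        exact mul_le_mul_of_nonneg_left (by linarith) (by positivity)

end Bessel

/-! ### Quadratic forms of the transport operators -/

section Slices

variable {d : ℕ} {R : Set (EuclideanSpace ℝ (Fin d))}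

/-- Reduces inequalities between quadratic forms on `V` to inequalities on the sphere for almost
every `r`. Integrability is carried along because linearity and monotonicity of the integral require
it. -/
lemma inner_eq_integral_slices {w v : V R} {F : S2 × EuclideanSpace ℝ (Fin d) → ℝ}
    (hF : w =ᵐ[phaseMeas R] F) :
    Integrable (fun r => ∫ s, F (s, r) * v (s, r) ∂surf) (spaceMeas R) ∧
      inner ℝ w v = ∫ r, ∫ s, F (s, r) * v (s, r) ∂surf ∂(spaceMeas R) := by
  have hae : (fun p => inner ℝ (w p) (v p)) =ᵐ[phaseMeas R] fun p => F p * v p := by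
    filter_upwards [hF] with p hp
    simp [hp, mul_comm]
  have hint : Integrable (fun p => F p * v p) (phaseMeas R) := (L2.integrable_inner w v).congr hae
  refine ⟨hint.integral_prod_right, ?_⟩
  rw [L2.inner_def, integral_congr_ae hae, integral_prod_symm _ hint]

lemma inner_mulOp_eq (σ : Linf R) (v : V R) :
    Integrable (fun r => σ r * ∫ s, v (s, r) * v (s, r) ∂surf) (spaceMeas R) ∧
      inner ℝ (mulOp σ v) v = ∫ r, σ r * ∫ s, v (s, r) * v (s, r) ∂surf ∂(spaceMeas R) := by
  have h := inner_eq_integral_slices (v := v) (mulOp_ae σ v)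
  simpa only [mul_assoc, integral_const_mul] using h

lemma inner_mulOp_angularOp_eq (σ : Linf R) (κ : C(S2 × S2, ℝ)) (v : V R) :
    Integrable (fun r => σ r *
        ∫ s, (∫ s', κ (s, s') * v (s', r) ∂surf) * v (s, r) ∂surf) (spaceMeas R) ∧
      inner ℝ (mulOp σ (angularOp κ v)) v =
        ∫ r, σ r * ∫ s, (∫ s', κ (s, s') * v (s', r) ∂surf) * v (s, r) ∂surf ∂(spaceMeas R) := by
  have hF : mulOp σ (angularOp κ v) =ᵐ[phaseMeas R]
      fun p => σ p.2 * ∫ s', κ (p.1, s') * v (s', p.2) ∂surf := by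
    filter_upwards [mulOp_ae σ (angularOp κ v), angularOp_ae κ v] with p h1 h2
    rw [h1, h2]
  have h := inner_eq_integral_slices (v := v) hF
  simpa only [mul_assoc, integral_const_mul] using h

lemma inner_scatK_eq (σs : Linf R) {g : ℝ} (hg0 : 0 ≤ g) (hg1 : g < 1) (v : V R) :
    Integrable (fun r => σs r * ∫ s, (∫ s', hgPhase g (cosAngle s s') * v (s', r) ∂surf) *
        v (s, r) ∂surf) (spaceMeas R) ∧
      inner ℝ (scatK σs g hg0 hg1 v) v =
        ∫ r, σs r * ∫ s, (∫ s', hgPhase g (cosAngle s s') * v (s', r) ∂surf) * v (s, r) ∂surf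
          ∂(spaceMeas R) :=
  inner_mulOp_angularOp_eq σs (hgKernel g hg0 hg1) v

lemma inner_mulOp_harmonicProj_eq (σ : Linf R) (h : C(S2, ℝ)) (v : V R) :
    Integrable (fun r => σ r * (∫ s, v (s, r) * h s ∂surf) ^ 2) (spaceMeas R) ∧
      inner ℝ (mulOp σ (harmonicProj R h v)) v =
        ∫ r, σ r * (∫ s, v (s, r) * h s ∂surf) ^ 2 ∂(spaceMeas R) := by
  have hF : mulOp σ (harmonicProj R h v) =ᵐ[phaseMeas R]
      fun p => σ p.2 * ((∫ s', v (s', p.2) * h s' ∂surf) * h p.1) := by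
    filter_upwards [mulOp_ae σ (harmonicProj R h v), harmonicProj_ae R h v] with p h1 h2
    rw [h1, h2]
  have hq := inner_eq_integral_slices (v := v) hF
  have e : ∀ r, ∫ s, σ r * ((∫ s', v (s', r) * h s' ∂surf) * h s) * v (s, r) ∂surf =
      σ r * (∫ s, v (s, r) * h s ∂surf) ^ 2 := fun r => by
    rw [sq, ← mul_assoc, ← integral_const_mul]
    congr 1
    ext s
    ring
  simpa only [e] using hq

lemma inner_scatKTrunc_eq (σs : Linf R) (g : ℝ) (H : ℕ → ℤ → C(S2, ℝ)) (N : ℕ) (v : V R) :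
    Integrable (fun r => σs r * ∑ l ∈ Finset.range (N + 1),
        g ^ l * degreeEnergy H (fun s => v (s, r)) l) (spaceMeas R) ∧
      inner ℝ (scatKTrunc σs g H N v) v = ∫ r, σs r * ∑ l ∈ Finset.range (N + 1),
        g ^ l * degreeEnergy H (fun s => v (s, r)) l ∂(spaceMeas R) := by
  have e : ∀ r, σs r * ∑ l ∈ Finset.range (N + 1), g ^ l * degreeEnergy H (fun s => v (s, r)) l =
      ∑ l ∈ Finset.range (N + 1), ∑ m ∈ Finset.Icc (-l : ℤ) l,
        g ^ l * (σs r * (∫ s, v (s, r) * H l m s ∂surf) ^ 2) := fun r => by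
    simp only [degreeEnergy, Finset.mul_sum]
    exact Finset.sum_congr rfl fun l _ => Finset.sum_congr rfl fun m _ => by ring
  have hint : ∀ l m, Integrable
      (fun r => g ^ l * (σs r * (∫ s, v (s, r) * H l m s ∂surf) ^ 2)) (spaceMeas R) :=
    fun l m => (inner_mulOp_harmonicProj_eq σs (H l m) v).1.const_mul _
  simp only [e]
  refine ⟨integrable_finsetSum _ fun l _ => integrable_finsetSum _ fun m _ => hint l m, ?_⟩
  rw [integral_finsetSum _ fun l _ => integrable_finsetSum _ fun m _ => hint l m]
  simp only [scatKTrunc, scatOpTrunc, ContinuousLinearMap.comp_apply,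
    sum_apply, smul_apply, map_sum, map_smul, sum_inner,
    real_inner_smul_left]
  refine Finset.sum_congr rfl fun l _ => ?_
  rw [integral_finsetSum _ fun m _ => hint l m, Finset.mul_sum]
  refine Finset.sum_congr rfl fun m _ => ?_
  rw [integral_const_mul, (inner_mulOp_harmonicProj_eq σs (H l m) v).2]

lemma norm_sq_eq_integral_slices (v : V R) :
    Integrable (fun r => ∫ s, v (s, r) * v (s, r) ∂surf) (spaceMeas R) ∧
      ‖v‖ ^ 2 = ∫ r, ∫ s, v (s, r) * v (s, r) ∂surf ∂(spaceMeas R) := by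
  rw [← real_inner_self_eq_norm_sq]
  exact inner_eq_integral_slices (Filter.EventuallyEq.refl _ _)

lemma scatRatio_nonneg (σa σs : Linf R) : 0 ≤ scatRatio σa σs := ENNReal.toReal_nonneg

/-- The ratio lies in `[0, 1]`, so its essential supremum is finite and `toReal` in `scatRatio` does
not collapse to `0`. -/
lemma le_scatRatio_mul {σa σs : Linf R} (hσs : ∀ᵐ r ∂(spaceMeas R), 0 ≤ σs r)
    (hσa : ∀ᵐ r ∂(spaceMeas R), 0 < σa r) :
    ∀ᵐ r ∂(spaceMeas R), σs r ≤ scatRatio σa σs * (σa r + σs r) := by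
  have hle : eLpNorm (fun r => σs r / (σa r + σs r)) ⊤ (spaceMeas R) ≤ ENNReal.ofReal 1 := by
    rw [eLpNorm_exponent_top]
    refine eLpNormEssSup_le_of_ae_bound ?_
    filter_upwards [hσs, hσa] with r h1 h2
    rw [Real.norm_of_nonneg (by positivity)]
    exact div_le_one_of_le₀ (by linarith) (by positivity)
  have hfin := ne_top_of_le_ne_top ENNReal.ofReal_ne_top hle
  filter_upwards [hσs, hσa, ae_le_eLpNormEssSup (f := fun r => σs r / (σa r + σs r))
    (μ := spaceMeas R)] with r h1 h2 h3
  rw [← eLpNorm_exponent_top] at h3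
  have h4 := ENNReal.toReal_mono hfin h3
  rw [toReal_enorm, Real.norm_of_nonneg (by positivity), div_le_iff₀ (by positivity)] at h4
  exact h4

end Slices

end RadiativeTransfer

end

/-! ### The two-sided estimate and invertibility -/

open RadiativeTransfer in
theorem lemma2p1 {d : ℕ} (R : Set (EuclideanSpace ℝ (Fin d)))
    (hRopen : IsOpen R) (hRconv : Convex ℝ R) (hRbdd : Bornology.IsBounded R)
    (hRne : R.Nonempty)
    (σa σs : Linf R)
    (hσs : ∀ᵐ r ∂(spaceMeas R), 0 ≤ σs r)
    (hσa : ∃ γ : ℝ, 0 < γ ∧ ∀ᵐ r ∂(spaceMeas R), γ ≤ σa r)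
    (g : ℝ) (hg0 : 0 ≤ g) (hg1 : g < 1)
    (H : ℕ → ℤ → C(S2, ℝ)) (hH : IsSphericalHarmonics H) (N : ℕ) :
    (∀ v : V R,
      (1 - scatRatio σa σs * g ^ (N + 1)) *
          inner ℝ ((attOp σa σs - scatKTrunc σs g H N) v) v
        ≤ inner ℝ ((attOp σa σs - scatK σs g hg0 hg1) v) v ∧
      inner ℝ ((attOp σa σs - scatK σs g hg0 hg1) v) v
        ≤ inner ℝ ((attOp σa σs - scatKTrunc σs g H N) v) v) ∧
    IsUnit (attOp σa σs - scatKTrunc σs g H N) := by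
  obtain ⟨γ, hγ, hσa⟩ := hσa
  have hσt := Lp.coeFn_add σa σs
  have hratio := le_scatRatio_mul hσs (hσa.mono fun r hr => hγ.trans_le hr)
  have hc := scatRatio_nonneg σa σs
  set c := scatRatio σa σs
  have hG : 0 ≤ g ^ (N + 1) := by positivity
  refine ⟨fun v => ?_, ?_⟩
  · obtain ⟨hMi, hM⟩ := inner_mulOp_eq (σa + σs) v
    obtain ⟨hKi, hK⟩ := inner_scatK_eq σs hg0 hg1 v
    obtain ⟨hTi, hT⟩ := inner_scatKTrunc_eq σs g H N v
    simp only [sub_apply, inner_sub_left, attOp]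
    rw [hM, hK, hT, ← integral_sub hMi hKi, ← integral_sub hMi hTi, ← integral_const_mul]
    constructor
    · refine integral_mono_ae ((hMi.sub hTi).const_mul _) (hMi.sub hKi) ?_
      filter_upwards [hσs, hσa, hσt, hratio, slice_memLp v] with r h1 h2 h3 h4 hf
      -- `range (N + 1)` covers the degrees `l ≤ N`, so the first omitted power is `g ^ (N + 1)`.
      have hq := hg_sub_sum_pow_mul_degreeEnergy_le hH hg0 hg1 hf (N + 1)
      have hle := sum_pow_mul_degreeEnergy_le (H := H) (f := fun s => v (s, r)) hg0 hg1 (N + 1)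
      have hB := sum_degreeEnergy_le hH hf (N + 1)
      have hq0 : 0 ≤ ∑ l ∈ Finset.range (N + 1), g ^ l * degreeEnergy H (fun s => v (s, r)) l :=
        Finset.sum_nonneg fun l _ => mul_nonneg (by positivity) (degreeEnergy_nonneg _ _ _)
      simp only [h3, Pi.add_apply]
      set E := ∫ s, v (s, r) * v (s, r) ∂surf
      set Q := ∫ s, (∫ s', hgPhase g (cosAngle s s') * v (s', r) ∂surf) * v (s, r) ∂surf
      set q := ∑ l ∈ Finset.range (N + 1), g ^ l * degreeEnergy H (fun s => v (s, r)) l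
      set B := ∑ l ∈ Finset.range (N + 1), degreeEnergy H (fun s => v (s, r)) l
      -- The goal amounts to `σ_s (Q - q) ≤ c g^(N+1) (σ_t E - σ_s q)`. Split `σ_t E - σ_s q = σ_t
      -- (E - B) + (σ_t B - σ_s q)`: `c` times the first part dominates `σ_s (E - B)`, and the
      -- second is nonnegative because `q ≤ B` and `σ_s ≤ σ_t`.
      have i1 : σs r * (Q - q) ≤ σs r * (g ^ (N + 1) * (E - B)) :=
        mul_le_mul_of_nonneg_left hq h1
      have i2 : 0 ≤ (c * (σa r + σs r) - σs r) * (E - B) :=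
        mul_nonneg (by linarith) (by linarith)
      have i3 : σs r * q ≤ (σa r + σs r) * B :=
        mul_le_mul (by linarith) hle hq0 (by linarith)
      have i4 := mul_le_mul_of_nonneg_left i3 hc
      have i5 : 0 ≤ g ^ (N + 1) * ((c * (σa r + σs r) - σs r) * (E - B) +
          (c * ((σa r + σs r) * B) - c * (σs r * q))) := mul_nonneg hG (by linarith)
      linarith
    · refine integral_mono_ae (hMi.sub hKi) (hMi.sub hTi) ?_
      filter_upwards [hσs, slice_memLp v] with r h1 hf
      exact sub_le_sub_left (mul_le_mul_of_nonneg_left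
        (sum_pow_mul_degreeEnergy_le_hg hH hg0 hg1 hf (N + 1)) h1) _
  -- Lax–Milgram with coercivity constant `γ`: on each slice `σ_s q ≤ σ_s E`, which leaves at least
  -- `σ_a E ≥ γ E`.
  · refine ContinuousLinearMap.isUnit_of_forall_le_norm_inner_map _ (c := ⟨γ, hγ.le⟩) hγ fun v => ?_
    obtain ⟨hMi, hM⟩ := inner_mulOp_eq (σa + σs) v
    obtain ⟨hTi, hT⟩ := inner_scatKTrunc_eq σs g H N v
    obtain ⟨hVi, hV⟩ := norm_sq_eq_integral_slices v
    refine le_trans ?_ (le_abs_self _)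
    simp only [sub_apply, inner_sub_left, attOp]
    rw [hM, hT, hV, ← integral_sub hMi hTi, ← integral_mul_const]
    refine integral_mono_ae (hVi.mul_const _) (hMi.sub hTi) ?_
    filter_upwards [hσs, hσa, hσt, slice_memLp v] with r h1 h2 h3 hf
    have hle := sum_pow_mul_degreeEnergy_le (H := H) (f := fun s => v (s, r)) hg0 hg1 (N + 1)
    have hB := sum_degreeEnergy_le hH hf (N + 1)
    have hE : 0 ≤ ∫ s, v (s, r) * v (s, r) ∂surf := integral_nonneg fun s => mul_self_nonneg _
    simp only [h3, Pi.add_apply]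
    have i1 := mul_le_mul_of_nonneg_left (hle.trans hB) h1
    have i2 := mul_le_mul_of_nonneg_right h2 hE
    change _ * γ ≤ _
    linarith
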